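/- Let $n\ge 1$, $L\ge 2$ and $h\ge 1$ be integers with $h\le L^{\lfloor n/2\rfloor}$. Let $K_L^n$ be the Hamming graph: its vertices are the strings of length $n$ over an alphabet of $L$ symbols, and two strings are adjacent if and only if they differ in exactly one coordinate. An $h$-extra edge-cut of a graph $G$ is a set $F$ of edges of $G$ such that $G-F$ is disconnected and every component of $G-F$ has at least $h$ vertices; $\lambda_h(G)$ is the minimum cardinality of an $h$-extra edge-cut. The $h$-th isoperimetric edge-connectivity is $$\gamma_h(G)=\min\{|[U,\overline U]| : U\subset V(G),\ |U|\ge h,\ |\overline U|\ge h\},$$ where $\overline U=V(G)\setminus U$ and $[U,\overline U]$ is the set of edges with one end in $U$ and the other in $\overline U$. Let $ex_h(G)$ be the maximum, over all sets $X$ of $h$ vertices of $G$, of the degree sum $2|E(G[X])|$ of the induced subgraph $G[X]$. Then $h$-extra edge-cuts of $K_L^n$ exist, vertex sets $U$ with $|U|\ge h$ and $|\overline U|\ge h$ exist, and $$\lambda_h(K_L^n)=\gamma_h(K_L^n)=(L-1)nh-ex_h(K_L^n).$$ Moreover, if $h=\sum_{i=0}^{s}a_iL^{b_i}$ with integers $b_0>b_1>\cdots>b_s\ge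 0$ and $a_i\in\{1,\dots,L-1\}$ is the base-$L$ decomposition of $h$, then $$ex_h(K_L^n)=\sum_{i=0}^{s}\bigl[(L-1)a_ib_iL^{b_i}+(a_i-1)a_iL^{b_i}\bigr]+2\sum_{i=0}^{s-1}\sum_{j=i+1}^{s}a_ia_jL^{b_j}.$$ -/

import Mathlib

open Finset

/-- The `L`-ary `n`-dimensional Hamming graph `K_L^n`, the `n`-th Cartesian power of the complete
graph `K_L`: the vertices are the strings of length `n` over `L` symbols, and two strings are
adjacent iff they differ in exactly one coordinate. -/
def hammingGraph (L n : ℕ) : SimpleGraph (Fin n → Fin L) where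
  Adj u v := ∃! j, u j ≠ v j
  symm := ⟨fun _ _ ⟨j, hj, hu⟩ => ⟨j, hj.symm, fun k hk => hu k hk.symm⟩⟩
  loopless := ⟨fun _ ⟨_, hj, _⟩ => hj rfl⟩

section

variable {V : Type*} [Fintype V] (G : SimpleGraph V)

/-- `F` is an `h`-extra edge-cut of `G`: a set of edges of `G` such that `G - F` is disconnected
and every component of `G - F` has at least `h` vertices. -/
def IsExtraEdgeCut (h : ℕ) (F : Finset (Sym2 V)) : Prop :=
  (F : Set (Sym2 V)) ⊆ G.edgeSet ∧
    ¬ (G.deleteEdges (F : Set (Sym2 V))).Connected ∧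
    ∀ c : (G.deleteEdges (F : Set (Sym2 V))).ConnectedComponent, h ≤ c.supp.ncard

/-- The `h`-extra edge-connectivity `λ_h(G)`: the minimum cardinality of an `h`-extra edge-cut
(meaningful when such a cut exists). -/
noncomputable def extraEdgeConnectivity (h : ℕ) : ℕ :=
  sInf {k | ∃ F : Finset (Sym2 V), IsExtraEdgeCut G h F ∧ #F = k}

open Classical in
/-- `|[U, Uᶜ]|`: the number of edges of `G` with one end in `U` and the other end outside `U`
(every such edge is counted once, as the pair whose first entry lies in `U`). -/
noncomputable def cutSize (U : Finset V) : ℕ := #(G.interedges U Uᶜ)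

open Classical in
/-- The `h`-th isoperimetric edge-connectivity `γ_h(G)`: the minimum of `|[U, Uᶜ]|` over the vertex
sets `U` with `|U| ≥ h` and `|Uᶜ| ≥ h` (meaningful when such a `U` exists). -/
noncomputable def isoperimetricEdgeConnectivity (h : ℕ) : ℕ :=
  sInf {k | ∃ U : Finset V, h ≤ #U ∧ h ≤ #Uᶜ ∧ cutSize G U = k}

open Classical in
/-- `ex_m(G)`: the maximum, over the sets `X` of `m` vertices, of the sum of the degrees of the
induced subgraph `G[X]`. -/
noncomputable def maxInducedDegreeSum (m : ℕ) : ℕ :=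
  (powersetCard m (univ : Finset V)).sup fun X => ∑ v ∈ X, #{w ∈ X | G.Adj v w}

end

/-! Write D(m) for `cumDigitSum L m`. The Hamming graph is regular of degree (L-1)n, so the boundary
of an m-set has size (L-1)nm minus its induced degree sum. That degree sum is at most 2D(m)
(`inducedDegreeSum_le`), with equality for initial segments (`inducedDegreeSum_initialStrings`).

The bound goes by induction on n. Slicing along the first coordinate, the degree sum of X is that of
its slices plus |X_a ∩ X_b| over ordered pairs a ≠ b. Bounding each intersection by the smaller
slice and sorting the sizes leaves Σ (2D(m_i) + 2i·m_i) ≤ 2D(Σ m_i) for nonincreasing m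
(`cumDigitSum_sum_le`). This is an induction on m_0: sort the numbers below each m_i by last digit,
apply the hypothesis within each digit class, and meet the same inequality for the class totals,
which now differ by at most L. Such totals spread over two consecutive blocks of length L
(`cumDigitSum_nearly_balanced`), where the claim concerns cells of an L×L grid weighted by row +
column: among staircase shapes, row-by-row filling is heaviest (`antitone_rows_le_rowFill`).

It remains to minimise over the size: between h and L^n - h, `cutBound` is smallest at h
(`cutBound_le`). An initial segment and its complement stay connected once the boundary is removed,
so this boundary is an extra edge-cut; conversely every extra edge-cut contains the boundary of a
component. Peeling off leading digits evaluates D(h). -/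

/-- The sum of the base-`L` digits of `i`. -/
def digitSum (L i : ℕ) : ℕ := (Nat.digits L i).sum

/-- The sum of the base-`L` digits of the numbers below `m`. -/
def cumDigitSum (L m : ℕ) : ℕ := ∑ i ∈ range m, digitSum L i

/-! ### Grids filled row by row -/

/-- The total weight `row + column` of the first `N` cells of a grid with rows of length `B`,
filled row by row. -/
def rowFill (B N : ℕ) : ℕ := ∑ i ∈ range N, (i / B + i % B)

lemma rowFill_succ (B N : ℕ) : rowFill B (N + 1) = rowFill B N + (N / B + N % B) :=
  sum_range_succ _ _

lemma rowFill_of_le {B v : ℕ} (h : v ≤ B) : 2 * (rowFill B v : ℤ) = v * (v - 1) := by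
  induction v with
  | zero => simp [rowFill]
  | succ v ih =>
    rw [rowFill_succ, Nat.div_eq_of_lt (by omega), Nat.mod_eq_of_lt (by omega)]
    push_cast
    linarith [ih (by omega)]

lemma rowFill_mul_add {B : ℕ} (hB : 0 < B) (k x : ℕ) :
    rowFill B (k * B + x) = rowFill B (k * B) + k * x + rowFill B x := by
  induction x with
  | zero => simp [rowFill]
  | succ x ih =>
    rw [← add_assoc, rowFill_succ, rowFill_succ, ih, add_comm (k * B) x,
      Nat.add_mul_div_right _ _ hB, Nat.add_mul_mod_self_right]
    ring

lemma rowFill_mul {B : ℕ} (hB : 0 < B) (k : ℕ) :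
    2 * (rowFill B (k * B) : ℤ) = k * (B * (B - 1)) + k * (k - 1) * B := by
  induction k with
  | zero => simp [rowFill]
  | succ k ih =>
    rw [Nat.succ_mul, rowFill_mul_add hB]
    have := rowFill_of_le (le_refl B)
    push_cast
    linarith

lemma rowFill_mul_add' {B : ℕ} (hB : 0 < B) (k x : ℕ) :
    2 * (rowFill B (k * B + x) : ℤ) =
      k * (B * (B - 1)) + k * (k - 1) * B + 2 * k * x + 2 * rowFill B x := by
  rw [rowFill_mul_add hB]
  have := rowFill_mul hB k
  push_cast
  linarith

lemma rowFill_add_row {B : ℕ} (hB : 0 < B) (x : ℕ) :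
    2 * (rowFill B (B + x) : ℤ) = B * (B - 1) + 2 * x + 2 * rowFill B x := by
  have := rowFill_mul_add' hB 1 x
  rw [one_mul] at this
  rw [this]; push_cast; ring

/-- Full rows are removed from the larger part until both are shorter than B. If they then overflow
one row by r, twice the gain is 2(B-x)(B-y) + 2r. -/
lemma rowFill_superadd {B : ℕ} (hB : 0 < B) (x y : ℕ) :
    rowFill B x + rowFill B y ≤ rowFill B (x + y) := by
  induction hs : x + y using Nat.strong_induction_on generalizing x y with
  | _ s ih =>
    subst hs
    wlog hxy : y ≤ x generalizing x y
    · rw [add_comm x y, add_comm (rowFill B x)]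
      exact this y x (fun m hm a b hab => ih m (by omega) a b hab) (by omega)
    zify
    by_cases hx : B ≤ x
    · obtain ⟨x, rfl⟩ := Nat.exists_eq_add_of_le hx
      have h := ih (x + y) (by omega) x y rfl
      have h1 := rowFill_add_row hB x
      have h2 := rowFill_add_row hB (x + y)
      rw [← add_assoc] at h2
      zify at h
      push_cast at h2
      linarith [Int.natCast_nonneg y]
    · have h1 := rowFill_of_le (show x ≤ B by omega)
      have h2 := rowFill_of_le (show y ≤ B by omega)
      by_cases hs : x + y ≤ B
      · have h3 := rowFill_of_le hs
        push_cast at h3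
        nlinarith [mul_nonneg (Int.natCast_nonneg x) (Int.natCast_nonneg y)]
      · obtain ⟨r, hr⟩ := Nat.exists_eq_add_of_le (show B ≤ x + y by omega)
        have h3 := rowFill_add_row hB r
        have h4 := rowFill_of_le (show r ≤ B by omega)
        rw [hr]
        have hr' : (r : ℤ) = x + y - B := by
          have := congrArg (Nat.cast : ℕ → ℤ) hr
          push_cast at this
          linarith
        have hxB : (0 : ℤ) ≤ B - x := by have : (x : ℤ) ≤ B := by exact_mod_cast (by omega)
                                         linarith
        have hyB : (0 : ℤ) ≤ B - y := by have : (y : ℤ) ≤ B := by exact_mod_cast (by omega)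
                                         linarith
        have hr0 := Int.natCast_nonneg r
        rw [h4] at h3
        rw [hr'] at h3 hr0
        nlinarith [mul_nonneg hxB hyB]

lemma rowFill_sum_le {B : ℕ} (hB : 0 < B) (A : ℕ) (w : ℕ → ℕ) (hw : ∀ j < A, w j ≤ B) :
    ∑ j ∈ range A, (w j : ℤ) * (w j - 1) ≤ 2 * rowFill B (∑ j ∈ range A, w j) := by
  induction A with
  | zero => simp
  | succ A ih =>
    rw [sum_range_succ, sum_range_succ]
    have h1 := ih (fun j hj => hw j (by omega))
    have h2 := rowFill_superadd hB (∑ j ∈ range A, w j) (w A)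
    have h3 := rowFill_of_le (hw A (by omega))
    zify at h2
    linarith

/-- A half-turn of the k×B grid sends a cell of weight c to one of weight B + k - 2 - c and the last
y cells to the first y. -/
lemma rowFill_reverse {B : ℕ} (hB : 0 < B) (k y : ℕ) (hy : y ≤ k * B) :
    (rowFill B (k * B - y) : ℤ) = rowFill B (k * B) - (B + k - 2) * y + rowFill B y := by
  induction y with
  | zero => simp [rowFill]
  | succ y ih =>
    have h := ih (by omega)
    have e : k * B - y = (k * B - (y + 1)) + 1 := by omega
    rw [e, rowFill_succ] at h
    rw [rowFill_succ]
    have hyk : y / B < k := Nat.div_lt_of_lt_mul (by rw [mul_comm]; omega)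
    have hyb : y % B < B := Nat.mod_lt _ hB
    have hdm := Nat.div_add_mod y B
    set a := y / B
    set b := y % B
    obtain ⟨c, rfl⟩ := Nat.exists_eq_add_of_lt hyk
    obtain ⟨d, hd⟩ := Nat.exists_eq_add_of_lt hyb
    have e2 : (a + c + 1) * B - (y + 1) = d + B * c := by
      have : (a + c + 1) * B = B * a + B * c + B := by ring
      omega
    have e3 : (d + B * c) / B = c := by
      rw [Nat.add_mul_div_left _ _ hB, Nat.div_eq_of_lt (by omega), zero_add]
    have e4 : (d + B * c) % B = d := by
      rw [Nat.add_mul_mod_self_left, Nat.mod_eq_of_lt (by omega)]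
    rw [e2] at h ⊢
    rw [e3, e4] at h
    have hd' : (B : ℤ) = b + d + 1 := by exact_mod_cast hd
    push_cast at h ⊢
    linear_combination h + (2 * (y : ℤ) + 1 - y - y - 1 + 1) * hd'

/-- After the half-turn, superadditivity says that Z consecutive cells weigh at least as much as the
first Z. -/
lemma rowFill_sub_le {B : ℕ} (hB : 0 < B) (k N Z : ℕ) (hN : N ≤ k * B) (hZ : Z ≤ N) :
    (rowFill B N : ℤ) - rowFill B (N - Z) ≤ (B + k - 2) * Z - rowFill B Z := by
  have h1 := rowFill_reverse hB k (k * B - N) (by omega)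
  have h2 := rowFill_reverse hB k (k * B - N + Z) (by omega)
  have h3 := rowFill_superadd hB (k * B - N) Z
  rw [show k * B - (k * B - N) = N by omega] at h1
  rw [show k * B - (k * B - N + Z) = N - Z by omega] at h2
  zify at h3
  push_cast at h2
  rw [h1, h2]
  linarith

lemma rowFill_le_succ {C N : ℕ} (hC : 0 < C) (hN : N ≤ C * C) :
    rowFill C N ≤ rowFill (C + 1) N := by
  have hr : N % C < C := Nat.mod_lt _ hC
  have hq : N / C ≤ C := Nat.div_le_of_le_mul hN
  have hdm := Nat.div_add_mod' N C
  set q := N / C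
  set r := N % C
  have h1 := rowFill_mul_add' hC q r
  rw [rowFill_of_le hr.le, hdm] at h1
  have hrz : (r : ℤ) ≤ C := by exact_mod_cast hr.le
  have hqz : (q : ℤ) ≤ C := by exact_mod_cast hq
  have hr0 := Int.natCast_nonneg r
  have hq0 := Int.natCast_nonneg q
  zify
  by_cases hqr : q ≤ r
  -- The partial row has enough cells to lengthen each of the q full rows by one.
  · obtain ⟨x, hx⟩ := Nat.exists_eq_add_of_le hqr
    have h2 := rowFill_mul_add' (show 0 < C + 1 by omega) q x
    rw [rowFill_of_le (show x ≤ C + 1 by omega),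
      show q * (C + 1) + x = N by rw [← hdm, hx]; ring] at h2
    have hx' : (x : ℤ) = r - q := by rw [hx]; push_cast; ring
    rw [hx'] at h2
    push_cast at h2
    nlinarith [mul_nonneg hq0 (sub_nonneg.2 hrz)]
  -- Here r < q, so a full row is broken up: q - 1 rows of length C + 1 remain, and the other cells
  -- fit in one row.
  · obtain ⟨p, hp⟩ := Nat.exists_eq_add_of_le (show 1 ≤ q by omega)
    have h2 := rowFill_mul_add' (show 0 < C + 1 by omega) p (C + r - p)
    rw [rowFill_of_le (show C + r - p ≤ C + 1 by omega)] at h2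
    have hx' : ((C + r - p : ℕ) : ℤ) = C + r + 1 - q := by
      rw [Nat.cast_sub (by omega), hp]; push_cast; ring
    have hN' : p * (C + 1) + (C + r - p) = N := by
      zify
      rw [hx', ← hdm, hp]; push_cast; ring
    rw [hN', hx'] at h2
    have hp' : (p : ℤ) = q - 1 := by rw [hp]; push_cast; ring
    rw [hp'] at h2
    push_cast at h2
    nlinarith [mul_nonneg hr0 (sub_nonneg.2 hqz)]

/-- The left side is twice the weight of a staircase shape with rows v i inside a B×B square. A full
first row or full first column can be removed, each costing the same; otherwise the square can be
shrunk. -/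
lemma antitone_rows_le_rowFill (A B : ℕ) (v : ℕ → ℕ) (hv : Antitone v) (hAB : A ≤ B)
    (hB : v 0 ≤ B) :
    ∑ i ∈ range A, ((v i : ℤ) * (v i - 1) + 2 * i * v i) ≤
      2 * rowFill B (∑ i ∈ range A, v i) := by
  induction hk : A + B + ∑ i ∈ range A, v i using Nat.strong_induction_on
    generalizing A B v with
  | _ k ih =>
    rcases Nat.eq_zero_or_pos A with rfl | hA
    · simp
    obtain ⟨A, rfl⟩ : ∃ A', A = A' + 1 := ⟨A - 1, by omega⟩
    have hBpos : 0 < B := by omega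
    rcases hB.eq_or_lt with hfull | hlt
    · have h := ih _ (by rw [← hk, sum_range_succ' (n := A)]; omega) A B (fun i => v (i + 1))
        (fun i j hij => hv (by omega)) (by omega) ((hv (by omega)).trans hB) rfl
      rw [sum_range_succ', sum_range_succ' (n := A), hfull, add_comm _ B, rowFill_add_row hBpos]
      have e : ∑ i ∈ range A, ((v (i + 1) : ℤ) * (v (i + 1) - 1) + 2 * (i + 1 : ℕ) * v (i + 1)) =
          ∑ i ∈ range A, ((v (i + 1) : ℤ) * (v (i + 1) - 1) + 2 * i * v (i + 1)) +
            2 * ((∑ i ∈ range A, v (i + 1) : ℕ) : ℤ) := by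
        push_cast
        rw [mul_sum, ← sum_add_distrib]
        exact sum_congr rfl fun i _ => by ring
      rw [e]
      push_cast at h ⊢
      linarith
    rcases hAB.eq_or_lt with hsq | hAB'
    · rcases Nat.eq_zero_or_pos (v A) with h0 | hpos
      · rw [sum_range_succ, sum_range_succ, h0]
        have h := ih _ (by rw [← hk, sum_range_succ, h0]; omega) A B v hv (by omega) hB rfl
        simpa using h
      -- The first column has B cells of weights 0, …, B - 1, exactly like a full first row, and its
      -- removal lowers every other weight by one.
      · have hge : ∀ i ∈ range (A + 1), 1 ≤ v i := fun i hi =>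
          hpos.trans_le (hv (by rw [mem_range] at hi; omega))
        have es : ∑ i ∈ range (A + 1), v i = B + ∑ i ∈ range (A + 1), (v i - 1) := by
          rw [show B = ∑ i ∈ range (A + 1), 1 by simp [← hsq], ← sum_add_distrib]
          exact sum_congr rfl fun i hi => by have := hge i hi; omega
        have h := ih _ (by rw [← hk, es]; omega) (A + 1) B (fun i => v i - 1)
          (fun i j hij => Nat.sub_le_sub_right (hv hij) 1) hAB (by omega) rfl
        rw [es, rowFill_add_row hBpos]
        have e : ∑ i ∈ range (A + 1), ((v i : ℤ) * (v i - 1) + 2 * i * v i) =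
            ∑ i ∈ range (A + 1), (((v i - 1 : ℕ) : ℤ) * ((v i - 1 : ℕ) - 1)
              + 2 * i * (v i - 1 : ℕ)) +
            2 * ((∑ i ∈ range (A + 1), (v i - 1) : ℕ) : ℤ) + ∑ i ∈ range (A + 1), 2 * (i : ℤ) := by
          push_cast
          rw [mul_sum, ← sum_add_distrib, ← sum_add_distrib]
          refine sum_congr rfl fun i hi => ?_
          rw [Nat.cast_sub (hge i hi)]
          push_cast
          ring
        have e2 : ∑ i ∈ range (A + 1), 2 * (i : ℤ) = B * (B - 1) := by
          rw [← hsq, ← mul_sum]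
          have := Finset.sum_range_id_mul_two (A + 1)
          zify at this
          push_cast at this ⊢
          linarith
        rw [e, e2]
        linarith
    -- The shape fits in a square of side B - 1; `rowFill_le_succ` returns to row length B.
    · obtain ⟨C, rfl⟩ : ∃ C, B = C + 1 := ⟨B - 1, by omega⟩
      have h := ih _ (by rw [← hk]; omega) (A + 1) C v hv (by omega) (by omega) rfl
      have hN : ∑ i ∈ range (A + 1), v i ≤ C * C := by
        calc ∑ i ∈ range (A + 1), v i ≤ ∑ i ∈ range (A + 1), C :=
              sum_le_sum fun i _ => (hv (Nat.zero_le i)).trans (by omega)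
          _ ≤ C * C := by simpa using Nat.mul_le_mul_right C (show A + 1 ≤ C by omega)
      have h2 := rowFill_le_succ (show 0 < C by omega) hN
      zify at h2
      exact h.trans (by linarith)

/-! ### Digit sums and their partial sums -/

lemma digitSum_mul_add {L : ℕ} (hL : 2 ≤ L) (q r : ℕ) (hr : r < L) :
    digitSum L (L * q + r) = digitSum L q + r := by
  unfold digitSum
  by_cases h : r ≠ 0 ∨ q ≠ 0
  · rw [add_comm, Nat.digits_add L hL r q hr h, List.sum_cons, add_comm]
  · push Not at h
    simp [h.1, h.2]

lemma digitSum_succ_le {L : ℕ} (hL : 2 ≤ L) (t : ℕ) :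
    digitSum L (t + 1) ≤ digitSum L t + 1 := by
  induction t using Nat.strong_induction_on with
  | _ t ih =>
    have hdm := Nat.div_add_mod t L
    have hr : t % L < L := Nat.mod_lt _ (by omega)
    set q := t / L with hq
    set r := t % L
    rw [← hdm, digitSum_mul_add hL q r hr]
    rcases Nat.lt_or_ge (r + 1) L with h | h
    · rw [add_assoc, digitSum_mul_add hL q _ h]
      omega
    · have e : L * q + r + 1 = L * (q + 1) + 0 := by rw [mul_add]; omega
      rw [e, digitSum_mul_add hL _ _ (by omega)]
      rcases Nat.eq_zero_or_pos t with h0 | h0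
      · rw [h0, Nat.zero_div] at hq
        have := ih
        simp only [hq] at *
        simp [digitSum, Nat.digits_of_lt L 1 (by norm_num) (by omega)]
      · have := ih q (Nat.div_lt_self h0 (by omega))
        omega

lemma digitSum_mul_pow_add {L : ℕ} (hL : 2 ≤ L) (p a i : ℕ) (hi : i < L ^ p) :
    digitSum L (a * L ^ p + i) = digitSum L a + digitSum L i := by
  induction p generalizing i with
  | zero =>
    obtain rfl : i = 0 := by simpa using hi
    simp [digitSum]
  | succ p ih =>
    have hdm := Nat.div_add_mod i L
    have hr : i % L < L := Nat.mod_lt _ (by omega)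
    have hq : i / L < L ^ p := Nat.div_lt_of_lt_mul (by rwa [pow_succ'] at hi)
    set q := i / L
    set r := i % L
    rw [← hdm, show a * L ^ (p + 1) + (L * q + r) = L * (a * L ^ p + q) + r by ring,
      digitSum_mul_add hL _ _ hr, digitSum_mul_add hL _ _ hr, ih q hq, add_assoc]

lemma digitSum_of_lt {L a : ℕ} (h : a < L) : digitSum L a = a := by
  rcases Nat.eq_zero_or_pos a with rfl | h0
  · simp [digitSum]
  · simp [digitSum, Nat.digits_of_lt L a h0.ne' h]

lemma cumDigitSum_succ (L m : ℕ) :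
    cumDigitSum L (m + 1) = cumDigitSum L m + digitSum L m := sum_range_succ _ _

lemma cumDigitSum_mul_pow_add {L : ℕ} (hL : 2 ≤ L) (p a r : ℕ) (hr : r ≤ L ^ p) :
    cumDigitSum L (a * L ^ p + r) =
      cumDigitSum L (a * L ^ p) + digitSum L a * r + cumDigitSum L r := by
  induction r with
  | zero => simp [cumDigitSum]
  | succ r ih =>
    rw [← add_assoc, cumDigitSum_succ, cumDigitSum_succ, ih (by omega),
      digitSum_mul_pow_add hL p a r (by omega)]
    ring

lemma cumDigitSum_mul_pow {L : ℕ} (hL : 2 ≤ L) (p a : ℕ) :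
    cumDigitSum L (a * L ^ p) = a * cumDigitSum L (L ^ p) + L ^ p * cumDigitSum L a := by
  induction a with
  | zero => simp [cumDigitSum]
  | succ a ih =>
    rw [Nat.succ_mul, cumDigitSum_mul_pow_add hL p a _ le_rfl, ih, cumDigitSum_succ]
    ring

lemma cumDigitSum_of_le {L a : ℕ} (h : a ≤ L) : 2 * (cumDigitSum L a : ℤ) = a * (a - 1) := by
  induction a with
  | zero => simp [cumDigitSum, digitSum]
  | succ a ih =>
    rw [cumDigitSum_succ, digitSum_of_lt (by omega)]
    push_cast
    linarith [ih (by omega)]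

lemma cumDigitSum_pow {L : ℕ} (hL : 2 ≤ L) (p : ℕ) :
    2 * (cumDigitSum L (L ^ p) : ℤ) = p * (L - 1) * L ^ p := by
  induction p with
  | zero => simp [cumDigitSum, digitSum]
  | succ p ih =>
    rw [pow_succ', cumDigitSum_mul_pow hL]
    have := cumDigitSum_of_le (le_refl L)
    push_cast
    linear_combination (L : ℤ) * ih + (L : ℤ) ^ p * this

/-- Splitting off the leading digit. -/
lemma cumDigitSum_leading {L : ℕ} (hL : 2 ≤ L) (p a r : ℕ) (ha : a < L) (hr : r ≤ L ^ p) :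
    2 * (cumDigitSum L (a * L ^ p + r) : ℤ) =
      (L - 1) * a * p * L ^ p + (a - 1) * a * L ^ p + 2 * a * r + 2 * cumDigitSum L r := by
  rw [cumDigitSum_mul_pow_add hL p a r hr, cumDigitSum_mul_pow hL, digitSum_of_lt ha]
  have h1 := cumDigitSum_of_le ha.le
  have h2 := cumDigitSum_pow hL p
  push_cast
  linear_combination (a : ℤ) * h2 + (L : ℤ) ^ p * h1

lemma cumDigitSum_eq_rowFill {L : ℕ} (hL : 2 ≤ L) {W : ℕ} (hW : W ≤ L ^ 2) :
    cumDigitSum L W = rowFill L W := by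
  refine sum_congr rfl fun i hi => ?_
  have hi : i < L * L := by rw [mem_range] at hi; rw [pow_two] at hW; omega
  conv_lhs => rw [← Nat.div_add_mod i L]
  rw [digitSum_mul_add hL _ _ (Nat.mod_lt _ (by omega)),
    digitSum_of_lt (Nat.div_lt_of_lt_mul hi)]

lemma cumDigitSum_last_digit {L : ℕ} (hL : 2 ≤ L) (q r : ℕ) (hr : r ≤ L) :
    2 * (cumDigitSum L (L * q + r) : ℤ) =
      2 * L * cumDigitSum L q + L * (L - 1) * q + 2 * digitSum L q * r + r * (r - 1) := by
  have h := cumDigitSum_mul_pow_add hL 1 q r (by simpa using hr)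
  have h2 := cumDigitSum_mul_pow hL 1 q
  have h3 := cumDigitSum_of_le hr
  have h4 := cumDigitSum_of_le (le_refl L)
  simp only [pow_one] at h h2
  rw [mul_comm L q, h, h2]
  push_cast
  linear_combination h3 + (q : ℤ) * h4

/-- The quotient on the left counts the numbers below m with last digit j. -/
lemma div_lastDigit {L : ℕ} (m j : ℕ) (hj : j < L) :
    (m + (L - 1 - j)) / L = m / L + if j < m % L then 1 else 0 := by
  have hdm := Nat.div_add_mod m L
  have hr : m % L < L := Nat.mod_lt _ (by omega)
  set q := m / L
  set r := m % L
  rw [← hdm, add_assoc, Nat.mul_add_div (by omega)]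
  congr 1
  split_ifs with h
  · exact Nat.div_eq_of_lt_le (by omega) (by omega)
  · exact Nat.div_eq_of_lt (by omega)

lemma sum_range_ite_lt {M : Type*} [AddCommMonoid M] {L r : ℕ} (hr : r ≤ L) (f : ℕ → M) :
    ∑ j ∈ range L, (if j < r then f j else 0) = ∑ j ∈ range r, f j := by
  rw [← sum_filter]
  congr 1
  ext j
  simp only [mem_filter, mem_range]
  omega

lemma two_mul_sum_range_cast (r : ℕ) : 2 * ∑ j ∈ range r, (j : ℤ) = r * (r - 1) := by
  induction r with
  | zero => simp
  | succ r ih => rw [sum_range_succ, mul_add, ih]; push_cast; ring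

/-- The numbers below `m` are classified by their last digit. -/
lemma sum_lastDigit {L : ℕ} (hL : 2 ≤ L) (m : ℕ) :
    ∑ j ∈ range L, (m + (L - 1 - j)) / L = m := by
  rw [sum_congr rfl fun j hj => div_lastDigit m j (mem_range.1 hj), sum_add_distrib]
  have hr : m % L < L := Nat.mod_lt _ (by omega)
  rw [sum_range_ite_lt hr.le (fun _ => 1)]
  simpa using Nat.div_add_mod m L

lemma cumDigitSum_split_lastDigit {L : ℕ} (hL : 2 ≤ L) (m : ℕ) :
    2 * (cumDigitSum L m : ℤ) = ∑ j ∈ range L, (2 * (cumDigitSum L ((m + (L - 1 - j)) / L) : ℤ) +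
      2 * j * ((m + (L - 1 - j)) / L : ℕ)) := by
  have hr : m % L < L := Nat.mod_lt _ (by omega)
  have hm := cumDigitSum_last_digit hL (m / L) (m % L) hr.le
  rw [Nat.div_add_mod] at hm
  have h : ∀ j ∈ range L, (2 * (cumDigitSum L ((m + (L - 1 - j)) / L) : ℤ) +
      2 * j * ((m + (L - 1 - j)) / L : ℕ)) =
      (2 * cumDigitSum L (m / L) + 2 * j * (m / L : ℕ)) +
        if j < m % L then 2 * (digitSum L (m / L) : ℤ) + 2 * j else 0 := by
    intro j hj
    rw [div_lastDigit m j (mem_range.1 hj)]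
    split_ifs
    · rw [cumDigitSum_succ]; push_cast; ring
    · simp
  rw [sum_congr rfl h, sum_add_distrib, sum_range_ite_lt hr.le, hm]
  simp only [sum_add_distrib, ← mul_sum, ← sum_mul, two_mul_sum_range_cast, sum_const, card_range,
    nsmul_eq_mul]
  push_cast
  ring

/-! ### The digit-sum inequality -/

/-- Each M j exceeds a common multiple L·t by a_j cells of block t and, once that block is full, w_j
cells of block t + 1. Passing to the next block raises the digit sum by at most one, so everything
reduces to the two staircase shapes a and w in the L×L grid. -/
lemma cumDigitSum_nearly_balanced {L : ℕ} (hL : 2 ≤ L) (M : ℕ → ℕ) (hM : Antitone M)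
    (hbal : M 0 ≤ M (L - 1) + L) :
    ∑ j ∈ range L, (2 * (cumDigitSum L (M j) : ℤ) + 2 * j * M j) ≤
      2 * cumDigitSum L (∑ j ∈ range L, M j) := by
  have hL0 : 0 < L := by omega
  set t := M (L - 1) / L with ht
  have hdm := Nat.div_add_mod (M (L - 1)) L
  have hu : M (L - 1) % L < L := Nat.mod_lt _ hL0
  rw [← ht] at hdm
  set a : ℕ → ℕ := fun j => min (M j - L * t) L with ha
  set w : ℕ → ℕ := fun j => M j - L * t - L with hw
  have hge : ∀ j ∈ range L, L * t ≤ M j := fun j hj => by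
    have := hM (show j ≤ L - 1 by rw [mem_range] at hj; omega)
    omega
  have hMj : ∀ j ∈ range L, M j = L * t + (a j + w j) := fun j hj => by
    have := hge j hj
    simp only [ha, hw]; omega
  have haL : ∀ j, a j ≤ L := fun j => min_le_right _ _
  have hwL : ∀ j, w j ≤ L := fun j => by
    have := hM (Nat.zero_le j)
    simp only [hw]; omega
  have ha_anti : Antitone a := fun i j hij => by
    have := hM hij
    simp only [ha]; omega
  have hw_anti : Antitone w := fun i j hij => by
    have := hM hij
    simp only [hw]; omega
  have haw : ∀ j, w j ≠ 0 → a j = L := fun j h => by simp only [ha, hw] at *; omega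
  obtain ⟨σ, hσ⟩ : ∃ σ : ℤ, σ = digitSum L t := ⟨_, rfl⟩
  obtain ⟨τ, hτ⟩ : ∃ τ : ℤ, τ = digitSum L (t + 1) := ⟨_, rfl⟩
  have hτσ : τ ≤ σ + 1 := by rw [hσ, hτ]; exact_mod_cast digitSum_succ_le hL t
  have hrow : ∀ j ∈ range L, 2 * (cumDigitSum L (M j) : ℤ) =
      2 * cumDigitSum L (L * t) + 2 * σ * (a j + w j) + (a j : ℤ) * (a j - 1) +
        (2 * (τ - σ) * w j + (w j : ℤ) * (w j - 1)) := by
    intro j hj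
    have h0 := cumDigitSum_last_digit hL t 0 (Nat.zero_le _)
    have h1 := cumDigitSum_last_digit hL t (a j) (haL j)
    rw [hMj j hj, hσ, hτ]
    by_cases h : w j = 0
    · rw [h]
      push_cast at h0 h1 ⊢
      simp only [add_zero] at h0 h1 ⊢
      linarith
    · rw [haw j h] at h1 ⊢
      have h2 := cumDigitSum_last_digit hL (t + 1) (w j) (hwL j)
      have h3 := cumDigitSum_last_digit hL (t + 1) 0 (Nat.zero_le _)
      rw [show L * (t + 1) + 0 = L * t + L by ring] at h3
      rw [show L * t + (L + w j) = L * (t + 1) + w j by ring]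
      push_cast at h0 h1 h2 h3 ⊢
      simp only [add_zero] at h0 h1 h2 h3 ⊢
      linarith
  set Aₛ := ∑ j ∈ range L, a j with hAs
  set Ω := ∑ j ∈ range L, w j with hΩ
  have hsum : ∑ j ∈ range L, M j = L ^ 2 * t + (Aₛ + Ω) := by
    rw [sum_congr rfl hMj, sum_add_distrib, sum_add_distrib]
    simp only [sum_const, card_range, smul_eq_mul]
    ring
  have hA_le : Aₛ ≤ L ^ 2 := by
    calc Aₛ ≤ ∑ j ∈ range L, L := sum_le_sum fun j _ => haL j
      _ = L ^ 2 := by simp [pow_two]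
  have hΩ_le : Ω ≤ L ^ 2 := by
    calc Ω ≤ ∑ j ∈ range L, L := sum_le_sum fun j _ => hwL j
      _ = L ^ 2 := by simp [pow_two]
  set PA : ℤ := ∑ j ∈ range L, ((a j : ℤ) * (a j - 1) + 2 * j * a j) with hPA
  set PW : ℤ := ∑ j ∈ range L, ((w j : ℤ) * (w j - 1) + 2 * j * w j) with hPW
  have hlhs : ∑ j ∈ range L, (2 * (cumDigitSum L (M j) : ℤ) + 2 * j * M j) =
      2 * cumDigitSum L (L ^ 2 * t) + 2 * σ * (Aₛ + Ω) + PA + 2 * (τ - σ) * Ω + PW := by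
    have h1 : ∀ j ∈ range L, (2 * (cumDigitSum L (M j) : ℤ) + 2 * j * M j) =
        (2 * cumDigitSum L (L * t) + (2 * j) * (L * t)) + (2 * σ * a j + 2 * σ * w j) +
        ((a j : ℤ) * (a j - 1) + 2 * j * a j) + 2 * (τ - σ) * w j +
        ((w j : ℤ) * (w j - 1) + 2 * j * w j) := by
      intro j hj
      rw [hrow j hj]
      rw [hMj j hj]
      push_cast
      ring
    have h2 := cumDigitSum_last_digit hL (L * t) 0 (Nat.zero_le _)
    rw [add_zero, ← mul_assoc, ← pow_two] at h2
    rw [sum_congr rfl h1]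
    simp only [sum_add_distrib, ← mul_sum, ← sum_mul, hPA, hPW, hAs, hΩ]
    rw [two_mul_sum_range_cast]
    simp only [sum_const, card_range, nsmul_eq_mul]
    push_cast at h2 ⊢
    rw [h2]
    ring
  have hPA_le : PA ≤ 2 * rowFill L Aₛ := antitone_rows_le_rowFill L L a ha_anti le_rfl (haL 0)
  have hPW_le : PW ≤ 2 * rowFill L Ω := antitone_rows_le_rowFill L L w hw_anti le_rfl (hwL 0)
  rw [hlhs, hsum]
  -- Either both shapes fit together into one L×L grid, or the cells of w complete the grid of a and
  -- the remainder starts a new one.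
  rcases Nat.le_total (Aₛ + Ω) (L ^ 2) with hW | hW
  · have hR := cumDigitSum_mul_pow_add hL 2 t (Aₛ + Ω) hW
    rw [mul_comm t] at hR
    rw [hR, cumDigitSum_eq_rowFill hL hW]
    have hAdm := Nat.div_add_mod' Aₛ L
    obtain ⟨k, hk⟩ : ∃ k, k = Aₛ / L := ⟨_, rfl⟩
    obtain ⟨ρ, hρ⟩ : ∃ ρ, ρ = Aₛ % L := ⟨_, rfl⟩
    rw [← hk, ← hρ] at hAdm
    -- A nonempty row j of w forces rows 0, …, j of a to be full. This pays for the extra 1 per cell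
    -- of w when its cells are placed after k full rows.
    have hjk : ∀ j ∈ range L, w j ≠ 0 → j + 1 ≤ k := by
      intro j hj hne
      rw [hk, Nat.le_div_iff_mul_le hL0]
      calc (j + 1) * L = ∑ i ∈ range (j + 1), L := by simp
        _ ≤ ∑ i ∈ range (j + 1), a i := sum_le_sum fun i hi => by
            have h1 := ha_anti (show i ≤ j by rw [mem_range] at hi; omega)
            rw [haw j hne] at h1
            exact h1
        _ ≤ Aₛ := sum_le_sum_of_subset (range_subset_range.2 (by rw [mem_range] at hj; omega))
    have h1 : PW + 2 * Ω ≤ 2 * k * Ω + ∑ j ∈ range L, (w j : ℤ) * (w j - 1) := by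
      rw [hPW, hΩ]
      push_cast
      rw [mul_sum, mul_sum, ← sum_add_distrib, ← sum_add_distrib]
      refine sum_le_sum fun j hj => ?_
      by_cases h : w j = 0
      · simp [h]
      · have : ((j : ℤ) + 1) ≤ k := by exact_mod_cast hjk j hj h
        nlinarith [Int.natCast_nonneg (w j)]
    have h2 := rowFill_sum_le hL0 L w (fun j _ => hwL j)
    have h3 := rowFill_superadd hL0 ρ Ω
    have h4 := rowFill_mul_add' hL0 k ρ
    have h5 := rowFill_mul_add' hL0 k (ρ + Ω)
    rw [← add_assoc, hAdm] at h5
    rw [hAdm] at h4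
    zify at h3
    have h6 : (τ - σ) * Ω ≤ Ω :=
      mul_le_of_le_one_left (Int.natCast_nonneg Ω) (by linarith)
    rw [← hΩ] at h2
    push_cast at h5 ⊢
    rw [← hσ]
    linarith only [hPA_le, h1, h2, h3, h4, h5, h6]
  · obtain ⟨x, hx⟩ := Nat.exists_eq_add_of_le hW
    -- Z counts the holes of a; they are filled by the last Z cells of w, leaving x = Ω - Z.
    set Z := ∑ j ∈ range L, (L - a j) with hZ
    have hZA : Z + Aₛ = L ^ 2 := by
      rw [hZ, hAs, ← sum_add_distrib, sum_congr rfl fun j _ => Nat.sub_add_cancel (haL j)]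
      simp [pow_two]
    have hxle : x ≤ L ^ 2 := by omega
    have hR := cumDigitSum_mul_pow_add hL 2 (t + 1) x hxle
    have hR2 := cumDigitSum_mul_pow_add hL 2 t (L ^ 2) le_rfl
    rw [show t * L ^ 2 + L ^ 2 = (t + 1) * L ^ 2 by ring, mul_comm t] at hR2
    rw [hR2, cumDigitSum_eq_rowFill hL hxle, cumDigitSum_eq_rowFill hL le_rfl] at hR
    rw [hx, show L ^ 2 * t + (L ^ 2 + x) = (t + 1) * L ^ 2 + x by ring, hR]
    -- k = ⌈Ω/L⌉ rows hold all of w. Rows of a beside nonempty rows of w are full, so holes occur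
    -- only in rows j ≥ k.
    set k := (Ω + L - 1) / L with hk
    have hΩk : Ω ≤ k * L := by
      have := Nat.div_add_mod' (Ω + L - 1) L
      have := Nat.mod_lt (Ω + L - 1) hL0
      rw [← hk] at *
      omega
    have hkj : ∀ j ∈ range L, L - a j ≠ 0 → k ≤ j := by
      intro j hj hne
      rw [hk, Nat.div_le_iff_le_mul_add_pred hL0]
      have : Ω ≤ L * j := by
        have hz : ∀ i ∈ range L, i ∉ range j → w i = 0 := by
          intro i _ hi
          by_contra h
          have := ha_anti (show j ≤ i by rw [mem_range] at hi; omega)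
          rw [haw i h] at this
          have := haL j
          omega
        rw [hΩ, ← sum_subset (range_subset_range.2 (by rw [mem_range] at hj; omega : j ≤ L)) hz]
        calc ∑ i ∈ range j, w i ≤ ∑ i ∈ range j, L := sum_le_sum fun i _ => hwL i
          _ = L * j := by simp [mul_comm]
      omega
    have h1 := rowFill_sub_le hL0 k Ω Z hΩk (by omega)
    rw [show Ω - Z = x by omega] at h1
    have h2 := rowFill_sum_le hL0 L (fun j => L - a j) (fun j _ => Nat.sub_le _ _)
    have h3 : PA + 2 * (L - 2 + k) * Z - ∑ j ∈ range L, ((L - a j : ℕ) : ℤ) * ((L - a j : ℕ) - 1)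
        + 2 * Z ≤ 2 * rowFill L (L ^ 2) := by
      have h4 : 2 * (rowFill L (L ^ 2) : ℤ) =
          ∑ j ∈ range L, ((L : ℤ) * (L - 1) + 2 * j * L) := by
        rw [pow_two, rowFill_mul hL0]
        simp only [sum_add_distrib, ← mul_sum, ← sum_mul, two_mul_sum_range_cast, sum_const,
          card_range, nsmul_eq_mul]
      rw [h4, hPA, hZ]
      push_cast
      rw [mul_sum, mul_sum, ← sum_add_distrib, ← sum_sub_distrib, ← sum_add_distrib]
      refine sum_le_sum fun j hj => ?_
      have hz : (a j : ℤ) = L - (L - a j : ℕ) := by rw [Nat.cast_sub (haL j)]; ring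
      have hkz : (k : ℤ) * (L - a j : ℕ) ≤ j * (L - a j : ℕ) := by
        by_cases h : L - a j = 0
        · simp [h]
        · exact_mod_cast Nat.mul_le_mul_right _ (hkj j hj h)
      generalize ((L - a j : ℕ) : ℤ) = z at hz hkz ⊢
      rw [hz]
      linarith only [hkz]
    have hxz : (Aₛ : ℤ) + Ω = L ^ 2 + x := by exact_mod_cast hx
    have hZz : (Z : ℤ) + Aₛ = L ^ 2 := by exact_mod_cast hZA
    have hZ0 := Int.natCast_nonneg Z
    have h5 : (τ - σ) * Z ≤ Z := mul_le_of_le_one_left hZ0 (by linarith)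
    have e : (x : ℤ) = Ω - Z := by linarith
    have e2 : (Aₛ : ℤ) = L ^ 2 - Z := by linarith
    rw [← hZ] at h2
    push_cast
    rw [e2, ← hτ, ← hσ, show (τ * (x : ℤ)) = τ * (Ω - Z) by rw [e]]
    linarith only [hPW_le, h1, h2, h3, h5]

/-- The digit-sum inequality behind the edge-isoperimetric theorem in Hamming graphs. -/
theorem cumDigitSum_sum_le {L : ℕ} (hL : 2 ≤ L) (m : ℕ → ℕ) (hm : Antitone m) :
    ∑ i ∈ range L, (2 * (cumDigitSum L (m i) : ℤ) + 2 * i * m i) ≤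
      2 * cumDigitSum L (∑ i ∈ range L, m i) := by
  induction hk : m 0 using Nat.strong_induction_on generalizing m with
  | _ k ih =>
    rcases Nat.le_or_ge (m 0) L with h0 | h0
    · have h := antitone_rows_le_rowFill L L m hm le_rfl h0
      have hW : ∑ i ∈ range L, m i ≤ L ^ 2 := by
        calc ∑ i ∈ range L, m i ≤ ∑ i ∈ range L, L :=
              sum_le_sum fun i _ => (hm (Nat.zero_le i)).trans h0
          _ = L ^ 2 := by simp [pow_two]
      rw [cumDigitSum_eq_rowFill hL hW]
      refine le_trans (le_of_eq (sum_congr rfl fun i _ => ?_)) h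
      rw [cumDigitSum_of_le ((hm (Nat.zero_le i)).trans h0)]
    · have hL0 : 0 < L := by omega
      -- c j i counts the numbers below m i with last digit j. For fixed i these counts differ by at
      -- most one, so their totals over i differ by at most L.
      set c : ℕ → ℕ → ℕ := fun j i => (m i + (L - 1 - j)) / L with hc
      have hci : ∀ j, Antitone (c j) := fun j i i' h =>
        Nat.div_le_div_right (by have := hm h; omega)
      have hlt : ∀ j, c j 0 < k := by
        intro j
        simp only [hc]
        rw [Nat.div_lt_iff_lt_mul hL0, ← hk]
        nlinarith [show m 0 + (L - 1 - j) < m 0 + L by omega]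
      set M : ℕ → ℕ := fun j => ∑ i ∈ range L, c j i with hMdef
      have hMsum : ∑ j ∈ range L, M j = ∑ i ∈ range L, m i := by
        simp only [hMdef, hc]
        rw [sum_comm]
        exact sum_congr rfl fun i _ => sum_lastDigit hL (m i)
      have hMa : Antitone M := fun j j' h => sum_le_sum fun i _ =>
        Nat.div_le_div_right (by omega)
      have hMb : M 0 ≤ M (L - 1) + L := by
        have : M (L - 1) + L = ∑ i ∈ range L, (c (L - 1) i + 1) := by
          simp [hMdef, sum_add_distrib]
        rw [this]
        refine sum_le_sum fun i _ => ?_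
        simp only [hc]
        rw [← Nat.add_div_right _ hL0]
        exact Nat.div_le_div_right (by omega)
      have hfin := cumDigitSum_nearly_balanced hL M hMa hMb
      rw [hMsum] at hfin
      refine le_trans ?_ hfin
      calc ∑ i ∈ range L, (2 * (cumDigitSum L (m i) : ℤ) + 2 * i * m i)
          = ∑ i ∈ range L, ∑ j ∈ range L,
              (2 * (cumDigitSum L (c j i) : ℤ) + 2 * i * c j i + 2 * j * c j i) := by
            refine sum_congr rfl fun i _ => ?_
            have e : (m i : ℤ) = ∑ j ∈ range L, (c j i : ℤ) := by
              exact_mod_cast (sum_lastDigit hL (m i)).symm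
            rw [cumDigitSum_split_lastDigit hL (m i), e, mul_sum, ← sum_add_distrib]
            exact sum_congr rfl fun j _ => by ring
        _ = ∑ j ∈ range L, (∑ i ∈ range L, (2 * (cumDigitSum L (c j i) : ℤ) + 2 * i * c j i) +
              2 * j * M j) := by
            rw [sum_comm]
            refine sum_congr rfl fun j _ => ?_
            rw [sum_add_distrib]
            simp only [hMdef]
            push_cast
            rw [mul_sum]
        _ ≤ _ := by
            refine sum_le_sum fun j _ => ?_
            have := ih _ (hlt j) (c j) (hci j) rfl
            linarith

/-! ### Minimising the boundary over the size -/

/-- The number of edges leaving the first `m` vertices of `K_L^n` in the lexicographic order. -/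
def cutBound (L n m : ℕ) : ℤ := ((L : ℤ) - 1) * n * m - 2 * cumDigitSum L m

lemma cutBound_leading {L : ℕ} (hL : 2 ≤ L) (n a r : ℕ) (ha : a < L) (hr : r ≤ L ^ n) :
    cutBound L (n + 1) (a * L ^ n + r) =
      a * (L - a) * L ^ n + (L - 1 - 2 * a) * r + cutBound L n r := by
  rw [cutBound, cutBound, cumDigitSum_leading hL n a r ha hr]
  push_cast
  ring

lemma cutBound_succ {L : ℕ} (hL : 2 ≤ L) (n r : ℕ) (hr : r ≤ L ^ n) :
    cutBound L (n + 1) r = (L - 1) * r + cutBound L n r := by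
  simpa using cutBound_leading hL n 0 r (by omega) hr

/-- Allowing r = L^n lets the full set m = L^(n+1) be treated with leading digit L - 1. -/
lemma exists_leading_digit {L : ℕ} (hL : 2 ≤ L) {n m : ℕ} (hm : m ≤ L ^ (n + 1)) :
    ∃ a r, a < L ∧ r ≤ L ^ n ∧ m = a * L ^ n + r := by
  have hK : 0 < L ^ n := by positivity
  rw [pow_succ'] at hm
  rcases hm.lt_or_eq with h | h
  · exact ⟨m / L ^ n, m % L ^ n, Nat.div_lt_of_lt_mul (by rwa [mul_comm]),
      (Nat.mod_lt _ hK).le, (Nat.div_add_mod' _ _).symm⟩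
  · refine ⟨L - 1, L ^ n, by omega, le_rfl, ?_⟩
    rw [h, ← Nat.succ_mul]
    congr 1
    omega

lemma cutBound_compl {L : ℕ} (hL : 2 ≤ L) (n m : ℕ) (hm : m ≤ L ^ n) :
    cutBound L n (L ^ n - m) = cutBound L n m := by
  induction n generalizing m with
  | zero =>
    have h1 : m = 0 ∨ m = 1 := by simp at hm; omega
    rcases h1 with rfl | rfl <;> simp [cutBound, cumDigitSum, digitSum]
  | succ n ih =>
    obtain ⟨a, r, ha, hr, rfl⟩ := exists_leading_digit hL hm
    have hLa : L - 1 - a + a + 1 = L := by omega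
    have e : L ^ (n + 1) - (a * L ^ n + r) = (L - 1 - a) * L ^ n + (L ^ n - r) := by
      have : L ^ (n + 1) = (L - 1 - a) * L ^ n + a * L ^ n + L ^ n := by
        rw [pow_succ']
        nth_rw 1 [← hLa]
        ring
      omega
    rw [e, cutBound_leading hL _ _ _ (by omega) (Nat.sub_le _ _), ih r hr,
      cutBound_leading hL _ _ _ ha hr]
    have h1 : ((L - 1 - a : ℕ) : ℤ) = L - 1 - a := by omega
    rw [h1, Nat.cast_sub hr]
    push_cast
    ring

lemma cutBound_nonneg {L : ℕ} (hL : 2 ≤ L) (n m : ℕ) (hm : m ≤ L ^ n) : 0 ≤ cutBound L n m := by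
  induction n generalizing m with
  | zero =>
    have h1 : m = 0 ∨ m = 1 := by simp at hm; omega
    rcases h1 with rfl | rfl <;> simp [cutBound, cumDigitSum, digitSum]
  | succ n ih =>
    obtain ⟨a, r, ha, hr, rfl⟩ := exists_leading_digit hL hm
    rw [cutBound_leading hL _ _ _ ha hr]
    have h1 : (0 : ℤ) ≤ L - 1 - a := by omega
    have h2 : (0 : ℤ) ≤ (L : ℤ) ^ n - r := by rw [sub_nonneg]; exact_mod_cast hr
    have h3 := ih r hr
    have h4 : (0 : ℤ) ≤ a * (L - a) * (L ^ n - r) :=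
      mul_nonneg (mul_nonneg (Int.natCast_nonneg a) (by linarith)) h2
    have h5 : (0 : ℤ) ≤ (a + 1) * (L - 1 - a) * r :=
      mul_nonneg (mul_nonneg (by positivity) h1) (Int.natCast_nonneg r)
    linarith

lemma succ_sub_mul_pow_le {L : ℕ} (hL : 2 ≤ L) {n k : ℕ} (hk : k ≤ n) :
    ((n : ℤ) + 1 - k) * L ^ k ≤ L ^ n := by
  obtain ⟨j, rfl⟩ := Nat.exists_eq_add_of_le hk
  have h : j + 1 ≤ L ^ j := Nat.lt_pow_self (by omega)
  have h' : (j : ℤ) + 1 ≤ (L : ℤ) ^ j := by exact_mod_cast h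
  rw [pow_add]
  push_cast
  have : (0 : ℤ) ≤ (L : ℤ) ^ k := by positivity
  nlinarith

/-- The lower bound is the value of `cutBound` at L^k. Induction on n by leading digit: digit L - 1
becomes digit 0 by complementation, and the intermediate digits already give (L-1)L^n. -/
lemma le_cutBound {L : ℕ} (hL : 2 ≤ L) (n k m : ℕ) (h1 : L ^ k ≤ m) (h2 : m + L ^ k ≤ L ^ n) :
    ((L : ℤ) - 1) * (n - k) * L ^ k ≤ cutBound L n m := by
  induction n generalizing m with
  | zero =>
    have : 0 < L ^ k := by positivity
    simp only [pow_zero] at h2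
    omega
  | succ n ih =>
    have hL0 : 0 < L := by omega
    have hLz : (0 : ℤ) ≤ (L : ℤ) - 1 := by omega
    have hkn : k ≤ n := by
      by_contra hc
      have := Nat.pow_le_pow_right hL0 (show n + 1 ≤ k by omega)
      have : 0 < L ^ k := by positivity
      omega
    have hbig := mul_le_mul_of_nonneg_left (succ_sub_mul_pow_le hL hkn) hLz
    have key : ∀ r : ℕ, r ≤ L ^ n → L ^ k ≤ r →
        ((L : ℤ) - 1) * ((n + 1 : ℕ) - k) * L ^ k ≤ cutBound L (n + 1) r := by
      intro r hr hkr
      rw [cutBound_succ hL n r hr]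
      by_cases hc : r + L ^ k ≤ L ^ n
      · have h3 := ih r hkr hc
        have h4 : ((L : ℤ) - 1) * L ^ k ≤ (L - 1) * r :=
          mul_le_mul_of_nonneg_left (by exact_mod_cast hkr) hLz
        push_cast
        linarith
      -- Here r is within L^k of L^n: the small complement contributes (L-1)(L^n - r), which
      -- together with (L-1)r makes (L-1)L^n.
      · have h3 : ((L : ℤ) - 1) * (L ^ n - r : ℕ) ≤ cutBound L n (L ^ n - r) := by
          rcases hkn.eq_or_lt with rfl | hlt
          · rw [show L ^ k - r = 0 by omega]
            simp [cutBound, cumDigitSum]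
          · obtain ⟨p, rfl⟩ : ∃ p, n = p + 1 := ⟨n - 1, by omega⟩
            have hle : L ^ (p + 1) - r ≤ L ^ p := by
              have := Nat.pow_le_pow_right hL0 (show k ≤ p by omega)
              omega
            rw [cutBound_succ hL p _ hle]
            linarith [cutBound_nonneg hL p _ hle]
        rw [cutBound_compl hL n r hr, Nat.cast_sub hr] at h3
        push_cast at h3 ⊢
        linarith
    obtain ⟨a, r, ha, hr, hm⟩ := exists_leading_digit hL (show m ≤ L ^ (n + 1) by omega)
    by_cases ha0 : a = 0
    · subst ha0
      rw [zero_mul, zero_add] at hm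
      subst hm
      exact key m hr h1
    by_cases ha1 : a = L - 1
    · rw [← cutBound_compl hL _ m (by omega)]
      refine key _ ?_ (by omega)
      have : L ^ (n + 1) = (L - 1) * L ^ n + L ^ n := by
        rw [pow_succ', ← Nat.succ_mul]
        congr 1
        omega
      rw [ha1] at hm
      omega
    · rw [hm, cutBound_leading hL _ _ _ ha hr]
      have h3 := cutBound_nonneg hL n r hr
      have h4 : (0 : ℤ) ≤ (L : ℤ) ^ n - r := by rw [sub_nonneg]; exact_mod_cast hr
      have h5 : (0 : ℤ) ≤ ((a : ℤ) - 1) * (L - 1 - a) * (L ^ n - r) :=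
        mul_nonneg (mul_nonneg (by omega) (by omega)) h4
      have h6 : (0 : ℤ) ≤ (a : ℤ) * (L - 2 - a) * r :=
        mul_nonneg (mul_nonneg (by omega) (by omega)) (Int.natCast_nonneg r)
      push_cast
      linarith

lemma digitSum_le {L : ℕ} (hL : 2 ≤ L) (k m : ℕ) (hm : m < L ^ k) :
    digitSum L m ≤ k * (L - 1) := by
  induction k generalizing m with
  | zero =>
    obtain rfl : m = 0 := by simpa using hm
    simp [digitSum]
  | succ k ih =>
    have hr : m % L < L := Nat.mod_lt _ (by omega)
    rw [← Nat.div_add_mod m L, digitSum_mul_add hL _ _ hr, Nat.succ_mul]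
    have := ih (m / L) (Nat.div_lt_of_lt_mul (by rwa [pow_succ'] at hm))
    omega

/-- The increment at m is (L-1)n - 2·`digitSum L m`, and numbers below L^k have digit sum at most
k(L-1). -/
lemma cutBound_mono {L : ℕ} (hL : 2 ≤ L) {n k h m : ℕ} (hk : 2 * k ≤ n) (hhm : h ≤ m)
    (hm : m ≤ L ^ k) : cutBound L n h ≤ cutBound L n m := by
  induction m, hhm using Nat.le_induction with
  | base => exact le_rfl
  | succ m _ ih =>
    refine (ih (by omega)).trans ?_
    rw [cutBound, cutBound, cumDigitSum_succ]
    have h1 := digitSum_le hL k m (by omega)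
    have h2 : 2 * (k * (L - 1)) ≤ n * (L - 1) := by
      rw [← mul_assoc]; exact Nat.mul_le_mul_right _ hk
    have h3 : 2 * (digitSum L m : ℤ) ≤ n * (L - 1 : ℕ) := by exact_mod_cast (by omega)
    rw [Nat.cast_sub (by omega)] at h3
    push_cast at h3 ⊢
    linarith

/-- Among the sizes between `h` and `L ^ n - h`, the boundary of an initial segment is smallest
at `h`, provided that `h ≤ L ^ (n / 2)`. -/
lemma cutBound_le {L : ℕ} (hL : 2 ≤ L) {n h m : ℕ} (hh : h ≤ L ^ (n / 2)) (hhm : h ≤ m)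
    (hm : m + h ≤ L ^ n) : cutBound L n h ≤ cutBound L n m := by
  have hk : 2 * (n / 2) ≤ n := Nat.mul_div_le n 2
  by_cases h1 : m ≤ L ^ (n / 2)
  · exact cutBound_mono hL hk hhm h1
  by_cases h2 : m + L ^ (n / 2) ≤ L ^ n
  · refine (cutBound_mono hL hk hh le_rfl).trans (le_trans (le_of_eq ?_)
      (le_cutBound hL n _ m (by omega) h2))
    rw [cutBound, cumDigitSum_pow hL]
    push_cast
    ring
  · rw [← cutBound_compl hL n m (by omega)]
    exact cutBound_mono hL hk (by omega) (by omega)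

/-! ### The base-`L` decomposition -/

lemma sum_mul_pow_lt {L : ℕ} (s : ℕ) (a b : Fin s → ℕ) (ha : ∀ i, a i < L)
    (hb : StrictAnti b) (c : ℕ) (hc : ∀ i, b i < c) (hL : 0 < L) :
    ∑ i, a i * L ^ b i < L ^ c := by
  induction s generalizing c with
  | zero => simpa using Nat.pow_pos hL
  | succ s ih =>
    rw [Fin.sum_univ_succ]
    have h := ih (fun i => a i.succ) (fun i => b i.succ) (fun i => ha _)
      (fun i j hij => hb (Fin.succ_lt_succ_iff.2 hij)) (b 0) (fun i => hb (Fin.succ_pos i))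
    calc _ < a 0 * L ^ b 0 + L ^ b 0 := by simpa using h
      _ = (a 0 + 1) * L ^ b 0 := by ring
      _ ≤ L * L ^ b 0 := Nat.mul_le_mul_right _ (ha 0)
      _ = L ^ (b 0 + 1) := (pow_succ' _ _).symm
      _ ≤ L ^ c := Nat.pow_le_pow_right hL (hc 0)

lemma cumDigitSum_decomposition {L : ℕ} (hL : 2 ≤ L) (s : ℕ) (a b : Fin s → ℕ)
    (ha : ∀ i, a i < L) (hb : StrictAnti b) :
    2 * (cumDigitSum L (∑ i, a i * L ^ b i) : ℤ) =
      ∑ i, (((L : ℤ) - 1) * a i * b i * (L : ℤ) ^ b i +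
          ((a i : ℤ) - 1) * a i * (L : ℤ) ^ b i) +
        2 * ∑ i, ∑ j ∈ Ioi i, (a i : ℤ) * a j * (L : ℤ) ^ b j := by
  induction s with
  | zero => simp [cumDigitSum]
  | succ s ih =>
    have hb' : StrictAnti fun i : Fin s => b i.succ :=
      fun i j hij => hb (Fin.succ_lt_succ_iff.2 hij)
    have hlt := sum_mul_pow_lt s (fun i => a i.succ) (fun i => b i.succ) (fun i => ha _) hb' (b 0)
      (fun i => hb (Fin.succ_pos i)) (by omega)
    have h := ih (fun i => a i.succ) (fun i => b i.succ) (fun i => ha _) hb'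
    rw [Fin.sum_univ_succ, cumDigitSum_leading hL _ _ _ (ha 0) hlt.le, h, Fin.sum_univ_succ,
      Fin.sum_univ_succ]
    simp only [Fin.Ioi_zero_eq_map, Fin.Ioi_succ, sum_map, Fin.coe_succEmb]
    push_cast
    have e : ∑ x : Fin s, (a 0 : ℤ) * a x.succ * (L : ℤ) ^ b x.succ =
        a 0 * ∑ x : Fin s, (a x.succ : ℤ) * (L : ℤ) ^ b x.succ := by
      rw [mul_sum]
      exact sum_congr rfl fun i _ => by ring
    rw [e]
    ring

/-! ### Edge boundaries and extra edge-cuts in a general graph -/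

section

variable {V : Type*} [Fintype V] (G : SimpleGraph V)

open Classical in
/-- The degree sum of the induced subgraph `G[X]`. -/
noncomputable def inducedDegreeSum (X : Finset V) : ℕ := ∑ v ∈ X, #{w ∈ X | G.Adj v w}

open Classical in
lemma cutSize_add_inducedDegreeSum (U : Finset V) :
    cutSize G U + inducedDegreeSum G U = ∑ v ∈ U, #{w | G.Adj v w} := by
  rw [cutSize, inducedDegreeSum, SimpleGraph.interedges, Rel.interedges, card_filter, sum_product,
    ← sum_add_distrib]
  refine sum_congr rfl fun v _ => ?_
  simp only [card_filter]
  rw [add_comm]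
  exact sum_add_sum_compl U _

open Classical in
/-- The set `[U, Uᶜ]` of edges with exactly one end in `U`. -/
noncomputable def edgeBoundary (U : Finset V) : Finset (Sym2 V) :=
  (G.interedges U Uᶜ).image fun p => s(p.1, p.2)

lemma mem_edgeBoundary {U : Finset V} {e : Sym2 V} :
    e ∈ edgeBoundary G U ↔ ∃ x ∈ U, ∃ y, y ∉ U ∧ G.Adj x y ∧ s(x, y) = e := by
  classical
  simp only [edgeBoundary, mem_image, SimpleGraph.mem_interedges_iff, Prod.exists, mem_compl]
  constructor
  · rintro ⟨x, y, ⟨hx, hy, h⟩, he⟩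
    exact ⟨x, hx, y, hy, h, he⟩
  · rintro ⟨x, hx, y, hy, h, he⟩
    exact ⟨x, y, ⟨hx, hy, h⟩, he⟩

lemma card_edgeBoundary (U : Finset V) : #(edgeBoundary G U) = cutSize G U := by
  classical
  rw [edgeBoundary, cutSize]
  convert card_image_of_injOn (s := G.interedges U Uᶜ) (f := fun p => s(p.1, p.2)) ?_
  rintro ⟨a, b⟩ h1 ⟨c, d⟩ h2 h
  simp only [mem_coe, SimpleGraph.mem_interedges_iff, mem_compl] at h1 h2
  rcases Sym2.eq_iff.1 h with ⟨rfl, rfl⟩ | ⟨rfl, rfl⟩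
  · rfl
  · exact absurd h1.1 h2.2.1

lemma mem_iff_of_adj_deleteEdges_edgeBoundary {U : Finset V} {x y : V}
    (h : (G.deleteEdges (edgeBoundary G U : Set (Sym2 V))).Adj x y) : x ∈ U ↔ y ∈ U := by
  rw [SimpleGraph.deleteEdges_adj, mem_coe, mem_edgeBoundary] at h
  by_contra hc
  rcases (not_iff.1 hc) with hc
  by_cases hy : y ∈ U
  · exact h.2 ⟨y, hy, x, hc.2 hy, h.1.symm, Sym2.eq_swap⟩
  · exact h.2 ⟨x, by tauto, y, hy, h.1, rfl⟩

lemma adj_deleteEdges_edgeBoundary {U : Finset V} {x y : V} (h : G.Adj x y)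
    (hxy : x ∈ U ↔ y ∈ U) : (G.deleteEdges (edgeBoundary G U : Set (Sym2 V))).Adj x y := by
  rw [SimpleGraph.deleteEdges_adj, mem_coe, mem_edgeBoundary]
  refine ⟨h, ?_⟩
  rintro ⟨a, ha, b, hb, _, he⟩
  rcases Sym2.eq_iff.1 he with ⟨rfl, rfl⟩ | ⟨rfl, rfl⟩ <;> tauto

lemma mem_iff_of_reachable_deleteEdges_edgeBoundary {U : Finset V} {x y : V}
    (h : (G.deleteEdges (edgeBoundary G U : Set (Sym2 V))).Reachable x y) : x ∈ U ↔ y ∈ U := by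
  obtain ⟨p⟩ := h
  induction p with
  | nil => exact Iff.rfl
  | cons hadj _ ih => exact (mem_iff_of_adj_deleteEdges_edgeBoundary G hadj).trans ih

/-- The boundary of a vertex set `U` such that both sides are large and connected is an extra
edge-cut. -/
lemma isExtraEdgeCut_edgeBoundary {h : ℕ} {U : Finset V} {o t : V} (ho : o ∈ U) (ht : t ∉ U)
    (hU : h ≤ #U) (hUc : h + #U ≤ Fintype.card V)
    (hUo : ∀ v ∈ U, (G.deleteEdges (edgeBoundary G U : Set (Sym2 V))).Reachable v o)
    (hUt : ∀ v, v ∉ U → (G.deleteEdges (edgeBoundary G U : Set (Sym2 V))).Reachable v t) :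
    IsExtraEdgeCut G h (edgeBoundary G U) := by
  classical
  refine ⟨?_, ?_, ?_⟩
  · intro e he
    obtain ⟨x, _, y, _, hxy, rfl⟩ := (mem_edgeBoundary G).1 (mem_coe.1 he)
    exact hxy
  · intro hc
    exact ht ((mem_iff_of_reachable_deleteEdges_edgeBoundary G (hc.preconnected o t)).1 ho)
  · intro c
    induction c using SimpleGraph.ConnectedComponent.ind with
    | _ v =>
      by_cases hv : v ∈ U
      · refine hU.trans ?_
        rw [← Set.ncard_coe_finset]
        refine Set.ncard_le_ncard (fun w hw => ?_) (Set.toFinite _)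
        rw [SimpleGraph.ConnectedComponent.mem_supp_iff, SimpleGraph.ConnectedComponent.eq]
        exact (hUo w hw).trans (hUo v hv).symm
      · have : h ≤ #Uᶜ := by rw [card_compl]; omega
        refine this.trans ?_
        rw [← Set.ncard_coe_finset]
        refine Set.ncard_le_ncard (fun w hw => ?_) (Set.toFinite _)
        rw [SimpleGraph.ConnectedComponent.mem_supp_iff, SimpleGraph.ConnectedComponent.eq]
        exact (hUt w (by simpa using hw)).trans (hUt v hv).symm

/-- An extra edge-cut contains the boundary of a vertex set both of whose sides are large. -/
lemma IsExtraEdgeCut.exists_cutSize_le [Nonempty V] {h : ℕ} {F : Finset (Sym2 V)}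
    (hF : IsExtraEdgeCut G h F) :
    ∃ U : Finset V, h ≤ #U ∧ #U + h ≤ Fintype.card V ∧ cutSize G U ≤ #F := by
  classical
  obtain ⟨_, hconn, hcomp⟩ := hF
  have hpre : ¬ (G.deleteEdges (F : Set (Sym2 V))).Preconnected := fun hp => hconn ⟨hp⟩
  unfold SimpleGraph.Preconnected at hpre
  push Not at hpre
  obtain ⟨u, v, huv⟩ := hpre
  set H := G.deleteEdges (F : Set (Sym2 V)) with hH
  set U : Finset V := {w | H.Reachable w u} with hU
  have h1 := hcomp (H.connectedComponentMk u)
  have h2 := hcomp (H.connectedComponentMk v)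
  have e1 : (H.connectedComponentMk u).supp = (U : Set V) := by
    ext w
    rw [SimpleGraph.ConnectedComponent.mem_supp_iff, SimpleGraph.ConnectedComponent.eq]
    simp [hU]
  have e2 : (H.connectedComponentMk v).supp ⊆ ((Uᶜ : Finset V) : Set V) := by
    intro w hw
    rw [SimpleGraph.ConnectedComponent.mem_supp_iff, SimpleGraph.ConnectedComponent.eq] at hw
    simp only [hU, coe_compl, Set.mem_compl_iff, mem_coe, mem_filter, mem_univ, true_and]
    exact fun hwu => huv (hwu.symm.trans hw)
  rw [e1, Set.ncard_coe_finset] at h1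
  have h3 := h2.trans (Set.ncard_le_ncard e2 (Set.toFinite _))
  rw [Set.ncard_coe_finset] at h3
  refine ⟨U, h1, by have := card_add_card_compl U; omega, ?_⟩
  rw [← card_edgeBoundary]
  refine card_le_card fun e he => ?_
  obtain ⟨x, hx, y, hy, hxy, rfl⟩ := (mem_edgeBoundary G).1 he
  by_contra hne
  refine hy ?_
  simp only [hU, mem_filter, mem_univ, true_and] at hx ⊢
  have hadj : H.Adj y x := by
    rw [hH, SimpleGraph.deleteEdges_adj]
    exact ⟨hxy.symm, by rwa [Sym2.eq_swap]⟩
  exact hadj.reachable.trans hx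

end

/-! ### Sorting the slice sizes -/

/-- The minimum is taken at the larger index, and a is the larger index of 2a ordered pairs. -/
lemma sum_sum_ne_min (g : ℕ → ℕ) (hg : Antitone g) (L : ℕ) :
    ∑ a ∈ range L, ∑ b ∈ range L, (if a ≠ b then min (g a) (g b) else 0) =
      ∑ a ∈ range L, 2 * a * g a := by
  induction L with
  | zero => simp
  | succ L ih =>
    have h1 : ∑ b ∈ range L, (if L ≠ b then min (g L) (g b) else 0) = L * g L := by
      rw [sum_congr rfl fun b hb => ?_, sum_const, card_range, smul_eq_mul]
      rw [mem_range] at hb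
      rw [if_pos (by omega), min_eq_left (hg hb.le)]
    have h2 : ∑ a ∈ range L, (if a ≠ L then min (g a) (g L) else 0) = L * g L := by
      rw [← h1]
      exact sum_congr rfl fun b _ => by rw [min_comm]; simp only [ne_comm]
    rw [sum_range_succ, sum_range_succ _ L, sum_range_succ _ L, h1]
    simp only [sum_range_succ _ L, sum_add_distrib]
    rw [ih, h2]
    simp
    ring

lemma cumDigitSum_sum_add_min_le {L : ℕ} (hL : 2 ≤ L) (m : Fin L → ℕ) :
    ∑ a, 2 * cumDigitSum L (m a) + ∑ a, ∑ b, (if a ≠ b then min (m a) (m b) else 0) ≤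
      2 * cumDigitSum L (∑ a, m a) := by
  obtain ⟨σ, hσ⟩ : ∃ σ : Equiv.Perm (Fin L), Antitone (m ∘ σ) :=
    ⟨Fin.revPerm.trans (Tuple.sort m), fun i j hij =>
      Tuple.monotone_sort m (Fin.rev_le_rev.2 hij)⟩
  set g : ℕ → ℕ := fun i => if h : i < L then m (σ ⟨i, h⟩) else 0 with hgdef
  have hg : Antitone g := by
    intro i j hij
    simp only [hgdef]
    by_cases hj : j < L
    · rw [dif_pos hj, dif_pos (hij.trans_lt hj)]
      exact hσ (show (⟨i, hij.trans_lt hj⟩ : Fin L) ≤ ⟨j, hj⟩ from hij)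
    · rw [dif_neg hj]; exact Nat.zero_le _
  have hgm : ∀ a : Fin L, m (σ a) = g a := fun a => by simp [hgdef]
  have h := cumDigitSum_sum_le hL g hg
  rw [← Equiv.sum_comp σ m, ← Equiv.sum_comp σ fun a => 2 * cumDigitSum L (m a),
    ← Equiv.sum_comp σ fun a => ∑ b, (if a ≠ b then min (m a) (m b) else 0)]
  have e : ∀ a, ∑ b, (if σ a ≠ b then min (m (σ a)) (m b) else 0) =
      ∑ b ∈ range L, (if (a : ℕ) ≠ b then min (g a) (g b) else 0) := by
    intro a
    rw [← Equiv.sum_comp σ, ← Fin.sum_univ_eq_sum_range fun b =>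
      (if (a : ℕ) ≠ b then min (g a) (g b) else 0)]
    refine sum_congr rfl fun b _ => ?_
    simp only [hgm, ne_eq, EmbeddingLike.apply_eq_iff_eq, Fin.ext_iff]
  rw [sum_congr rfl fun a _ => e a]
  simp only [hgm]
  rw [Fin.sum_univ_eq_sum_range g, Fin.sum_univ_eq_sum_range fun a => 2 * cumDigitSum L (g a),
    Fin.sum_univ_eq_sum_range fun a =>
      ∑ b ∈ range L, (if a ≠ b then min (g a) (g b) else 0), sum_sum_ne_min g hg,
    ← sum_add_distrib]
  zify
  exact h

/-! ### The edge-isoperimetric inequality in Hamming graphs -/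

section

variable {L n : ℕ}

lemma hammingGraph_adj_cons (a b : Fin L) (x y : Fin n → Fin L) :
    (hammingGraph L (n + 1)).Adj (Fin.cons a x) (Fin.cons b y) ↔
      (a = b ∧ (hammingGraph L n).Adj x y) ∨ (a ≠ b ∧ x = y) := by
  simp only [hammingGraph]
  constructor
  · rintro ⟨j, hj, hu⟩
    simp only at hj hu
    induction j using Fin.cases with
    | zero =>
      refine Or.inr ⟨by simpa using hj, funext fun i => ?_⟩
      by_contra hne
      exact Fin.succ_ne_zero i (hu i.succ (by simpa using hne))
    | succ j =>
      refine Or.inl ⟨?_, j, by simpa using hj, fun i hi => ?_⟩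
      · by_contra hne
        exact Fin.succ_ne_zero j (hu 0 (by simpa using hne)).symm
      · exact Fin.succ_injective _ (hu i.succ (by simpa using hi))
  · rintro (⟨rfl, j, hj, hu⟩ | ⟨hab, rfl⟩)
    · refine ⟨j.succ, by simpa using hj, fun i hi => ?_⟩
      induction i using Fin.cases with
      | zero => simp at hi
      | succ i => exact congrArg _ (hu i (by simpa using hi))
    · refine ⟨0, by simpa using hab, fun i hi => ?_⟩
      induction i using Fin.cases with
      | zero => rfl
      | succ i => simp at hi

lemma sum_fin_cons {M : Type*} [AddCommMonoid M] (f : (Fin (n + 1) → Fin L) → M) :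
    ∑ v, f v = ∑ a : Fin L, ∑ x : Fin n → Fin L, f (Fin.cons a x) := by
  rw [← Equiv.sum_comp (Fin.consEquiv fun _ => Fin L), Fintype.sum_prod_type]
  rfl

lemma exists_eq_fin_cons (v : Fin (n + 1) → Fin L) :
    ∃ (a : Fin L) (x : Fin n → Fin L), v = Fin.cons a x :=
  ⟨v 0, Fin.tail v, (Fin.cons_self_tail v).symm⟩

open Classical in
lemma card_hammingGraph_neighbors (v : Fin n → Fin L) :
    #{w | (hammingGraph L n).Adj v w} = (L - 1) * n := by
  induction n with
  | zero =>
    rw [mul_zero, card_eq_zero, filter_eq_empty_iff]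
    rintro w - ⟨j, _⟩
    exact j.elim0
  | succ n ih =>
    obtain ⟨a, x, rfl⟩ := exists_eq_fin_cons v
    rw [card_filter, sum_fin_cons]
    have h : ∀ b : Fin L, (∑ y : Fin n → Fin L,
        if (hammingGraph L (n + 1)).Adj (Fin.cons a x) (Fin.cons b y) then 1 else 0) =
        if a = b then (L - 1) * n else 1 := by
      intro b
      simp only [hammingGraph_adj_cons]
      split_ifs with hab
      · simp [hab, ← ih x]
      · simp [hab]
    rw [sum_congr rfl fun b _ => h b, ← add_sum_erase _ _ (mem_univ a), if_pos rfl,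
      sum_congr rfl fun b hb => if_neg (ne_of_mem_erase hb).symm]
    simp [card_erase_of_mem]
    ring

/-- The strings whose extension by the first symbol `a` lies in `X`. -/
def stringSlice (X : Finset (Fin (n + 1) → Fin L)) (a : Fin L) : Finset (Fin n → Fin L) :=
  {x | (Fin.cons a x : Fin (n + 1) → Fin L) ∈ X}

lemma mem_stringSlice {X : Finset (Fin (n + 1) → Fin L)} {a : Fin L} {x : Fin n → Fin L} :
    x ∈ stringSlice X a ↔ (Fin.cons a x : Fin (n + 1) → Fin L) ∈ X := by simp [stringSlice]

lemma sum_card_stringSlice (X : Finset (Fin (n + 1) → Fin L)) : ∑ a, #(stringSlice X a) = #X := by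
  conv_rhs => rw [← filter_univ_mem X]
  simp only [stringSlice, card_filter]
  rw [sum_fin_cons]

open Classical in
lemma inducedDegreeSum_eq_sum {V : Type*} [Fintype V] (G : SimpleGraph V) (X : Finset V) :
    inducedDegreeSum G X = ∑ v, ∑ w, if v ∈ X ∧ w ∈ X ∧ G.Adj v w then 1 else 0 := by
  rw [inducedDegreeSum, ← univ_inter X, ← sum_ite_mem, univ_inter]
  refine sum_congr rfl fun v _ => ?_
  split_ifs with hv
  · rw [card_filter, ← univ_inter X, ← sum_ite_mem, univ_inter]
    simp only [hv, true_and, ite_and]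
  · simp [hv]

lemma inducedDegreeSum_slices (X : Finset (Fin (n + 1) → Fin L)) :
    inducedDegreeSum (hammingGraph L (n + 1)) X =
      ∑ a, inducedDegreeSum (hammingGraph L n) (stringSlice X a) +
        ∑ a, ∑ b, (if a ≠ b then #(stringSlice X a ∩ stringSlice X b) else 0) := by
  classical
  rw [inducedDegreeSum_eq_sum, sum_fin_cons, ← sum_add_distrib]
  refine sum_congr rfl fun a _ => ?_
  simp only [sum_fin_cons]
  rw [sum_comm, inducedDegreeSum_eq_sum]
  have h : ∀ b, (∑ x : Fin n → Fin L, ∑ y : Fin n → Fin L,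
      if (Fin.cons a x : Fin (n + 1) → Fin L) ∈ X ∧ (Fin.cons b y : Fin (n + 1) → Fin L) ∈ X ∧
        (hammingGraph L (n + 1)).Adj (Fin.cons a x) (Fin.cons b y) then 1 else 0) =
      (if a = b then ∑ x : Fin n → Fin L, ∑ y : Fin n → Fin L,
        if x ∈ stringSlice X a ∧ y ∈ stringSlice X a ∧ (hammingGraph L n).Adj x y then 1 else 0 else 0) +
      (if a ≠ b then #(stringSlice X a ∩ stringSlice X b) else 0) := by
    intro b
    simp only [hammingGraph_adj_cons, ← mem_stringSlice]
    by_cases hab : a = b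
    · subst hab
      simp
    · rw [if_neg hab, if_pos hab, zero_add, ← filter_univ_mem (stringSlice X a ∩ stringSlice X b), card_filter]
      refine sum_congr rfl fun x _ => ?_
      simp only [hab, false_and, false_or, ne_eq, not_false_eq_true, true_and, mem_inter]
      rw [sum_eq_single x]
      · simp
      · intro y _ hy
        rw [if_neg (fun hc => hy hc.2.2.symm)]
      · simp
  have hs := sum_congr rfl fun b (_ : b ∈ (univ : Finset (Fin L))) => h b
  rw [sum_add_distrib, sum_ite_eq univ a, if_pos (mem_univ a)] at hs
  convert hs

open Classical in
lemma inducedDegreeSum_zero_dim (X : Finset (Fin 0 → Fin L)) :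
    inducedDegreeSum (hammingGraph L 0) X = 0 := by
  refine sum_eq_zero fun v _ => ?_
  rw [card_eq_zero, filter_eq_empty_iff]
  rintro w - ⟨j, _⟩
  exact j.elim0

/-- The edge-isoperimetric inequality in Hamming graphs. -/
theorem inducedDegreeSum_le (hL : 2 ≤ L) (X : Finset (Fin n → Fin L)) :
    inducedDegreeSum (hammingGraph L n) X ≤ 2 * cumDigitSum L #X := by
  induction n with
  | zero => rw [inducedDegreeSum_zero_dim]; exact Nat.zero_le _
  | succ n ih =>
    rw [inducedDegreeSum_slices, ← sum_card_stringSlice X]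
    refine le_trans (add_le_add (sum_le_sum fun a _ => ih (stringSlice X a))
      (sum_le_sum fun a _ => sum_le_sum fun b _ => ?_))
      (cumDigitSum_sum_add_min_le hL fun a => #(stringSlice X a))
    split_ifs
    · exact le_min (card_le_card inter_subset_left) (card_le_card inter_subset_right)
    · exact le_rfl

/-! ### Initial segments as extremal sets -/

/-- The number with the base-`L` digits `x`, the first one least significant. -/
def stringIndex (x : Fin n → Fin L) : ℕ := finFunctionFinEquiv x

lemma stringIndex_cons (a : Fin L) (x : Fin n → Fin L) :
    stringIndex (Fin.cons a x : Fin (n + 1) → Fin L) = a + L * stringIndex x := by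
  simp only [stringIndex, finFunctionFinEquiv_apply, Fin.sum_univ_succ, mul_sum]
  simp [pow_succ']
  exact sum_congr rfl fun i _ => by ring

lemma stringIndex_lt (x : Fin n → Fin L) : stringIndex x < L ^ n := (finFunctionFinEquiv x).2

lemma stringIndex_injective : Function.Injective (stringIndex (L := L) (n := n)) :=
  Fin.val_injective.comp finFunctionFinEquiv.injective

/-- The set of the `h` strings of smallest index. -/
def initialStrings (L n h : ℕ) : Finset (Fin n → Fin L) := {x | stringIndex x < h}

lemma mem_initialStrings {h : ℕ} {x : Fin n → Fin L} :
    x ∈ initialStrings L n h ↔ stringIndex x < h := by simp [initialStrings]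

lemma card_initialStrings {h : ℕ} (hh : h ≤ L ^ n) : #(initialStrings L n h) = h := by
  have : (initialStrings L n h).image stringIndex = range h := by
    ext i
    simp only [mem_image, mem_initialStrings, mem_range]
    constructor
    · rintro ⟨x, hx, rfl⟩
      exact hx
    · intro hi
      refine ⟨finFunctionFinEquiv.symm ⟨i, hi.trans_le hh⟩, ?_, ?_⟩ <;> simp [stringIndex, hi]
  rw [← card_image_of_injective _ stringIndex_injective, this, card_range]

lemma stringSlice_initialStrings (h : ℕ) (a : Fin L) :
    stringSlice (initialStrings L (n + 1) h) a = initialStrings L n ((h + (L - 1 - a)) / L) := by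
  ext x
  have ha := a.2
  rw [mem_stringSlice, mem_initialStrings, mem_initialStrings, stringIndex_cons, Nat.lt_iff_add_one_le,
    Nat.lt_iff_add_one_le, Nat.le_div_iff_mul_le (by omega), Nat.succ_mul, mul_comm L]
  omega

lemma initialStrings_inter (h k : ℕ) :
    initialStrings L n h ∩ initialStrings L n k = initialStrings L n (min h k) := by
  ext x
  simp [mem_initialStrings]

/-- As the first symbol is the last digit, the slices are nested initial segments of sizes given by
last-digit counts. Intersections thus equal minima, and `cumDigitSum_split_lastDigit` gives
equality. -/
lemma inducedDegreeSum_initialStrings (hL : 2 ≤ L) {h : ℕ} (hh : h ≤ L ^ n) :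
    inducedDegreeSum (hammingGraph L n) (initialStrings L n h) = 2 * cumDigitSum L h := by
  induction n generalizing h with
  | zero =>
    have h1 : h = 0 ∨ h = 1 := by simp at hh; omega
    rw [inducedDegreeSum_zero_dim]
    rcases h1 with rfl | rfl <;> simp [cumDigitSum, digitSum]
  | succ n ih =>
    set g : ℕ → ℕ := fun a => (h + (L - 1 - a)) / L with hg
    have hga : Antitone g := fun i j hij => Nat.div_le_div_right (by omega)
    have hle : ∀ a, g a ≤ L ^ n := by
      intro a
      rw [pow_succ] at hh
      exact Nat.le_of_lt_succ ((Nat.div_lt_iff_lt_mul (by omega)).2 (by rw [Nat.succ_mul]; omega))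
    rw [inducedDegreeSum_slices]
    have e1 : ∀ a : Fin L, inducedDegreeSum (hammingGraph L n)
        (stringSlice (initialStrings L (n + 1) h) a) = 2 * cumDigitSum L (g a) := fun a => by
      rw [stringSlice_initialStrings, ih (hle a)]
    have e2 : ∀ a : Fin L, ∑ b, (if a ≠ b then #(stringSlice (initialStrings L (n + 1) h) a ∩
        stringSlice (initialStrings L (n + 1) h) b) else 0) =
        ∑ b ∈ range L, (if (a : ℕ) ≠ b then min (g a) (g b) else 0) := fun a => by
      rw [← Fin.sum_univ_eq_sum_range fun b => (if (a : ℕ) ≠ b then min (g a) (g b) else 0)]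
      refine sum_congr rfl fun b _ => ?_
      rw [stringSlice_initialStrings, stringSlice_initialStrings, initialStrings_inter,
        card_initialStrings (min_le_of_left_le (hle a))]
      simp only [ne_eq, Fin.ext_iff, hg]
    rw [sum_congr rfl fun a _ => e1 a, sum_congr rfl fun a _ => e2 a,
      Fin.sum_univ_eq_sum_range fun a => 2 * cumDigitSum L (g a)]
    rw [Fin.sum_univ_eq_sum_range fun a =>
      ∑ b ∈ range L, (if a ≠ b then min (g a) (g b) else 0), sum_sum_ne_min g hga,
      ← sum_add_distrib]
    zify
    rw [cumDigitSum_split_lastDigit hL h]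

lemma maxInducedDegreeSum_hammingGraph (hL : 2 ≤ L) {h : ℕ} (hh : h ≤ L ^ n) :
    maxInducedDegreeSum (hammingGraph L n) h = 2 * cumDigitSum L h := by
  refine le_antisymm (Finset.sup_le fun X hX => ?_) ?_
  · have := inducedDegreeSum_le hL X
    rwa [(mem_powersetCard.1 hX).2] at this
  · rw [← inducedDegreeSum_initialStrings hL hh]
    exact Finset.le_sup (f := inducedDegreeSum (hammingGraph L n))
      (mem_powersetCard.2 ⟨subset_univ _, card_initialStrings hh⟩)

lemma cutSize_hammingGraph (hL : 2 ≤ L) (U : Finset (Fin n → Fin L)) :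
    (cutSize (hammingGraph L n) U : ℤ) =
      ((L : ℤ) - 1) * n * #U - inducedDegreeSum (hammingGraph L n) U := by
  have h := cutSize_add_inducedDegreeSum (hammingGraph L n) U
  rw [sum_congr rfl fun v _ => card_hammingGraph_neighbors v, sum_const, smul_eq_mul] at h
  have h' : (cutSize (hammingGraph L n) U : ℤ) + inducedDegreeSum (hammingGraph L n) U =
      #U * ((L - 1 : ℕ) * n) := by exact_mod_cast h
  rw [Nat.cast_sub (by omega)] at h'
  push_cast at h'
  linarith

lemma cutBound_le_cutSize (hL : 2 ≤ L) {h : ℕ} (hh : h ≤ L ^ (n / 2)) (U : Finset (Fin n → Fin L))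
    (hU : h ≤ #U) (hUc : #U + h ≤ L ^ n) : cutBound L n h ≤ cutSize (hammingGraph L n) U := by
  refine (cutBound_le hL hh hU hUc).trans ?_
  rw [cutSize_hammingGraph hL, cutBound]
  have h1 : (inducedDegreeSum (hammingGraph L n) U : ℤ) ≤ 2 * cumDigitSum L #U := by
    exact_mod_cast inducedDegreeSum_le hL U
  linarith

lemma cutSize_initialStrings (hL : 2 ≤ L) {h : ℕ} (hh : h ≤ L ^ n) :
    (cutSize (hammingGraph L n) (initialStrings L n h) : ℤ) = cutBound L n h := by
  rw [cutSize_hammingGraph hL, card_initialStrings hh, inducedDegreeSum_initialStrings hL hh,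
    cutBound]
  push_cast
  ring

/-- Resetting a nonzero digit to 0 lowers the index. Iterated, this joins any string of an initial
segment to the zero string inside the segment. -/
lemma exists_adj_stringIndex_lt (x : Fin n → Fin L) (hx : stringIndex x ≠ 0) :
    ∃ y, (hammingGraph L n).Adj x y ∧ stringIndex y < stringIndex x := by
  induction n with
  | zero => have := stringIndex_lt x; simp at this; omega
  | succ n ih =>
    obtain ⟨a, x, rfl⟩ := exists_eq_fin_cons x
    have ha := a.2
    by_cases h0 : (a : ℕ) = 0
    · rw [stringIndex_cons, h0, zero_add] at hx
      obtain ⟨y, hy, hlt⟩ := ih x (right_ne_zero_of_mul hx)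
      refine ⟨Fin.cons a y, (hammingGraph_adj_cons _ _ _ _).2 (Or.inl ⟨rfl, hy⟩), ?_⟩
      rw [stringIndex_cons, stringIndex_cons]
      exact Nat.add_lt_add_left (Nat.mul_lt_mul_of_pos_left hlt (by omega)) _
    · refine ⟨Fin.cons ⟨0, by omega⟩ x, (hammingGraph_adj_cons _ _ _ _).2
        (Or.inr ⟨fun h => h0 (congrArg Fin.val h), rfl⟩), ?_⟩
      rw [stringIndex_cons, stringIndex_cons]
      simp only
      omega

lemma exists_adj_lt_stringIndex (x : Fin n → Fin L) (hx : stringIndex x + 1 < L ^ n) :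
    ∃ y, (hammingGraph L n).Adj x y ∧ stringIndex x < stringIndex y := by
  induction n with
  | zero => simp at hx
  | succ n ih =>
    obtain ⟨a, x, rfl⟩ := exists_eq_fin_cons x
    have ha := a.2
    by_cases h0 : (a : ℕ) = L - 1
    · rw [stringIndex_cons, h0, pow_succ'] at hx
      obtain ⟨y, hy, hlt⟩ := ih x (Nat.lt_of_mul_lt_mul_left (a := L) (by rw [mul_add]; omega))
      refine ⟨Fin.cons a y, (hammingGraph_adj_cons _ _ _ _).2 (Or.inl ⟨rfl, hy⟩), ?_⟩
      rw [stringIndex_cons, stringIndex_cons]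
      exact Nat.add_lt_add_left (Nat.mul_lt_mul_of_pos_left hlt (by omega)) _
    · refine ⟨Fin.cons ⟨L - 1, by omega⟩ x, (hammingGraph_adj_cons _ _ _ _).2
        (Or.inr ⟨fun h => h0 (congrArg Fin.val h), rfl⟩), ?_⟩
      rw [stringIndex_cons, stringIndex_cons]
      simp only
      omega

lemma isExtraEdgeCut_initialStrings {h : ℕ} (hh : 1 ≤ h) (h2 : h + h ≤ L ^ n) :
    IsExtraEdgeCut (hammingGraph L n) h
      (edgeBoundary (hammingGraph L n) (initialStrings L n h)) := by
  set o : Fin n → Fin L := finFunctionFinEquiv.symm ⟨0, by omega⟩ with ho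
  set t : Fin n → Fin L := finFunctionFinEquiv.symm ⟨L ^ n - 1, by omega⟩ with ht
  have hoi : stringIndex o = 0 := by simp [stringIndex, ho]
  have hti : stringIndex t = L ^ n - 1 := by simp [stringIndex, ht]
  have hcard := card_initialStrings (L := L) (n := n) (show h ≤ L ^ n by omega)
  refine isExtraEdgeCut_edgeBoundary _ (o := o) (t := t) ?_ ?_ hcard.ge ?_ ?_ ?_
  · rw [mem_initialStrings]; omega
  · rw [mem_initialStrings]; omega
  · rw [hcard]; simpa using h2
  · intro v hv
    rw [mem_initialStrings] at hv
    induction hk : stringIndex v using Nat.strong_induction_on generalizing v with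
    | _ k ih =>
      by_cases h0 : stringIndex v = 0
      · rw [stringIndex_injective (h0.trans hoi.symm)]
      · obtain ⟨y, hy, hlt⟩ := exists_adj_stringIndex_lt v h0
        refine (adj_deleteEdges_edgeBoundary _ hy ?_).reachable.trans
          (ih _ (hk ▸ hlt) y (by omega) rfl)
        rw [mem_initialStrings, mem_initialStrings]
        omega
  · intro v hv
    rw [mem_initialStrings] at hv
    induction hk : L ^ n - stringIndex v using Nat.strong_induction_on generalizing v with
    | _ k ih =>
      have hvlt := stringIndex_lt v
      by_cases h0 : stringIndex v + 1 = L ^ n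
      · rw [stringIndex_injective (show stringIndex v = stringIndex t by omega)]
      · obtain ⟨y, hy, hlt⟩ := exists_adj_lt_stringIndex v (by omega)
        have hylt := stringIndex_lt y
        refine (adj_deleteEdges_edgeBoundary _ hy ?_).reachable.trans
          (ih _ (by omega) y (by omega) rfl)
        rw [mem_initialStrings, mem_initialStrings]
        omega

end

/-! ### The connectivities of the Hamming graph -/

theorem mainTheorem3 (n h L : ℕ) (hn : 1 ≤ n) (hh : 1 ≤ h) (hL : 2 ≤ L)
    (hle : h ≤ L ^ (n / 2)) :
    -- `h`-extra edge-cuts exist, and their minimum size is as claimed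
    (∃ F, IsExtraEdgeCut (hammingGraph L n) h F) ∧
    (extraEdgeConnectivity (hammingGraph L n) h : ℤ) =
      ((L : ℤ) - 1) * n * h - maxInducedDegreeSum (hammingGraph L n) h ∧
    -- the same value for the `h`-th isoperimetric edge-connectivity
    (∃ U : Finset (Fin n → Fin L), h ≤ #U ∧ h ≤ #Uᶜ) ∧
    (isoperimetricEdgeConnectivity (hammingGraph L n) h : ℤ) =
      ((L : ℤ) - 1) * n * h - maxInducedDegreeSum (hammingGraph L n) h ∧
    -- `ex_h` through the base-`L` decomposition `h = a₀ L^b₀ + ⋯ + aₛ L^bₛ`, `b₀ > ⋯ > bₛ`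
    ∀ (s : ℕ) (a b : Fin (s + 1) → ℕ), (∀ i, 1 ≤ a i ∧ a i < L) → StrictAnti b →
      h = ∑ i, a i * L ^ b i →
      (maxInducedDegreeSum (hammingGraph L n) h : ℤ) =
        ∑ i, (((L : ℤ) - 1) * a i * b i * (L : ℤ) ^ b i +
            ((a i : ℤ) - 1) * a i * (L : ℤ) ^ b i) +
          2 * ∑ i, ∑ j ∈ Ioi i, (a i : ℤ) * a j * (L : ℤ) ^ b j := by
  have hL0 : 0 < L := by omega
  have h2 : h + h ≤ L ^ n := by
    calc h + h ≤ 2 * L ^ (n / 2) := by omega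
      _ ≤ L * L ^ (n / 2) := Nat.mul_le_mul_right _ hL
      _ = L ^ (n / 2 + 1) := (pow_succ' _ _).symm
      _ ≤ L ^ n := Nat.pow_le_pow_right hL0 (by omega)
  have hex := maxInducedDegreeSum_hammingGraph (n := n) hL (show h ≤ L ^ n by omega)
  have hval : ((L : ℤ) - 1) * n * h - maxInducedDegreeSum (hammingGraph L n) h =
      cutBound L n h := by
    rw [hex, cutBound]; push_cast; ring
  have hcard := card_initialStrings (L := L) (n := n) (show h ≤ L ^ n by omega)
  have hcut := cutSize_initialStrings (n := n) hL (show h ≤ L ^ n by omega)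
  have hcardV : Fintype.card (Fin n → Fin L) = L ^ n := by simp
  have hF := isExtraEdgeCut_initialStrings hh h2
  have hne : Nonempty (Fin n → Fin L) := ⟨fun _ => ⟨0, hL0⟩⟩
  rw [hval, ← hcut]
  refine ⟨⟨_, hF⟩, ?_, ⟨initialStrings L n h, hcard.ge, ?_⟩, ?_, ?_⟩
  · have hmin : IsLeast {k | ∃ F, IsExtraEdgeCut (hammingGraph L n) h F ∧ #F = k}
        (cutSize (hammingGraph L n) (initialStrings L n h)) := by
      refine ⟨⟨_, hF, card_edgeBoundary _ _⟩, ?_⟩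
      rintro k ⟨F, hF, rfl⟩
      obtain ⟨U, hU1, hU2, hU3⟩ := hF.exists_cutSize_le
      rw [hcardV] at hU2
      refine le_trans ?_ hU3
      zify
      rw [hcut]
      exact cutBound_le_cutSize hL hle U hU1 hU2
    exact congrArg _ hmin.csInf_eq
  · rw [card_compl, hcard, hcardV]; omega
  · classical
    have hmin : IsLeast {k | ∃ U : Finset (Fin n → Fin L), h ≤ #U ∧ h ≤ #Uᶜ ∧
        cutSize (hammingGraph L n) U = k}
        (cutSize (hammingGraph L n) (initialStrings L n h)) := by
      refine ⟨⟨_, hcard.ge, ?_, rfl⟩, ?_⟩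
      · rw [card_compl, hcard, hcardV]; omega
      · rintro k ⟨U, hU1, hU2, rfl⟩
        rw [card_compl, hcardV] at hU2
        zify
        rw [hcut]
        exact cutBound_le_cutSize hL hle U hU1 (by omega)
    rw [isoperimetricEdgeConnectivity, ← hmin.csInf_eq]
    congr!
  · intro s a b ha hb hdec
    rw [hex]
    push_cast
    conv_lhs => rw [hdec]
    exact cumDigitSum_decomposition hL (s + 1) a b (fun i => (ha i).2) hb
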